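/- **Setting.** Let $\mathcal S,\mathcal A$ be finite sets, $S=|\mathcal S|\ge 2$, $A=|\mathcal A|$, let $\mathbb P:\mathcal S\times\mathcal A\to\triangle(\mathcal S)$ be a transition function known to the learner, $s^1\in\mathcal S$ an initial state, $T\ge 1$, and $\ell^1,\dots,\ell^T:\mathcal S\times\mathcal A\to[0,1]$ loss functions that are fixed in advance and unknown to the learner. At time $t$ the learner in state $s^t$ plays $a^t$, observes only $\ell^t(s^t,a^t)$ (bandit feedback), and moves to $s^{t+1}\sim\mathbb P(\cdot\mid s^t,a^t)$; there are no resets. Let $\Pi=\mathcal A^{\mathcal S}$ be the set of stationary deterministic policies, and let $\mu_\pi^t$ be the law of $(s^t,a^t)$ (also its state marginal) when $\pi$ is followed from $s^1$. The regret is $$\mathcal R_T=\mathbb E\Big[\sum_{t=1}^T\ell^t(s^t,a^t)\Big]-\min_{\pi\in\Pi}\sum_{t=1}^T\langle\mu_\pi^t,\ell^t\rangle .$$ Let $T(s'\mid\pi,s)$ be the first time at which $s'$ is reached from $s$ (at time $0$) under $\pi$. Assume that the MDP is communicating, i.e. has finite diameter $D=\max_{s\ne s'}\min_{\pi\in\Pi}\mathbb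 E[T(s'\mid\pi,s)]$, and that it has a parking state: $\mathbb P(s^*\mid s^*,a^*)=1$ for some $s^*\in\mathcal S$, $a^*\in\mathcal A$. A planning oracle returns, for any real costs $c=(c^t(s,a))_{t\le T,s,a}$, a minimizer $\pi\in\Pi$ of $\sum_{t=1}^T\langle\mu_\pi^t,c^t\rangle$ (ties broken by any measurable rule). **Switching procedure.** For $s\neq s'$ let $\pi_{s,s'}\in\Pi$ satisfy $\mathbb E[T(s'\mid\pi_{s,s'},s)]\le D$; for $g\ne s^*$ let $l_g\le 2D$ be an integer with $\Pr\{T(g\mid\pi_{s^*,g},s^*)=l_g\}\ge\frac1{4D}$; put $l_{s^*}=0$ and $l^*=\max_g l_g$. "Travelling towards $g$" means, starting in $s^*$, to play $a^*$ for $l^*-l_g$ steps and then $\pi_{s^*,g}$ for $l_g$ steps; $p_g$ is the probability of being in $g$ after these $l^*$ steps, and $p^*=\min_g p_g$. To switch to $\pi$, repeat: move from the current state $s$ to $s^*$ by $\pi_{s,s^*}$; if it is now time $t$, draw $g\sim\mu_\pi^{t+l^*}$ and travel towards $g$; if the current state is $g$, stop with probability $p^*/p_g$. **Algorithm**, with parameters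 $$\eta=\frac{S^{1/3}}{D^{2/3}T^{1/3}},\qquad J=\Big\lceil\frac{S^{2/3}A^{1/2}T^{5/6}}{D^{4/3}}\Big\rceil,\qquad L=\Big\lceil\frac{S^{1/3}A^{1/2}T^{1/6}}{D^{2/3}}\Big\rceil,\qquad H=\Big\lceil\frac TJ\Big\rceil .$$ Let $\hat\ell^t=0$ initially for all $t$. For the epochs $j=1,\dots,J$, with time slots $\mathcal T_j=\{(j-1)H+1,\dots,\min(jH,T)\}$: draw a fresh perturbation $z=(z^t(s,a))_{t\le T,s,a}$ with independent Laplace entries (density $\frac\eta2e^{-\eta|x|}$), and let the oracle compute $$\pi_j\in\operatorname*{argmin}_{\pi\in\Pi}\Big(\sum_{j'<j}\sum_{t\in\mathcal T_{j'}}\langle\mu_\pi^t,\hat\ell^t\rangle+\sum_{t=1}^T\langle\mu_\pi^t,z^t\rangle\Big).\tag{1}$$ Switch to $\pi_j$; then, in the time slots $t\in\mathcal T_j$ that remain, play $a^t=\pi_j(s^t)$ and estimate the loss by geometric re-sampling: for $m=1,2,\dots,L$ draw a fresh perturbation, let the oracle compute the policy $\pi'$ from (1) with it, and toss a coin with success probability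 $\mu_{\pi'}^t(s^t,a^t)$; let $M^t$ be the index of the first success, or $L$ if there is none, and set $\hat\ell^t(s,a)=\mathbb 1[(s,a)=(s^t,a^t)]\,\ell^t(s^t,a^t)\,M^t$. Everything stops after $T$ steps of interaction. **Theorem.** Under these assumptions, policies $\pi_{s,s'}$ and times $l_g$ as required exist. There are universal constants $C$ and $k$ such that, for all $\mathcal S,\mathcal A,\mathbb P,s^1,T,\ell$ as above and all choices of the oracle, $(s^*,a^*)$, $\pi_{s,s'}$ and $l_g$, the algorithm has regret $$\mathcal R_T\le C\,A^{1/2}(SD)^{2/3}T^{5/6}\,\big(1+\log(SAT)\big)^k,$$ that is, $\mathcal R_T=\tilde{\mathcal O}\big(A^{1/2}(SD)^{2/3}T^{5/6}\big)$. Moreover it is oracle-efficient: almost surely it makes at most $J+TL$ oracle calls and draws at most $(J+TL)\,SAT+TL+2T$ scalar random variables. -/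

import Mathlib

open scoped ENNReal

/-- The known part of a finite infinite-horizon adversarial Markov decision process: a
time-independent transition function and an initial state. -/
structure MDP (S A : Type*) where
  P : S → A → PMF S
  init : S

namespace MDP

variable {S A : Type*}

/-- The law of the state at time `t` (times are `0, 1, 2, …`) when the stationary deterministic
policy `π` is followed from the initial state. -/
noncomputable def stateLaw (M : MDP S A) (π : S → A) : ℕ → PMF S
  | 0 => PMF.pure M.init
  | t + 1 => (M.stateLaw π t).bind fun s => M.P s (π s)

/-- The occupancy measure of `π` at time `t`: the probability of visiting `(s, a)` at time `t`. -/
noncomputable def occ [DecidableEq A] (M : MDP S A) (π : S → A) (t : ℕ) (s : S) (a : A) : ℝ≥0∞ :=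
  if a = π s then M.stateLaw π t s else 0

/-- `∑_{t < T} ⟨μ_π^t, c^t⟩`, the expected cumulative cost over `T` steps of the policy `π`, for the
real-valued costs `c`. -/
noncomputable def policyCost [Fintype S] [Fintype A] [DecidableEq A] (M : MDP S A) {T : ℕ}
    (c : Fin T × S × A → ℝ) (π : S → A) : ℝ :=
  ∑ i : Fin T × S × A, (M.occ π i.1 i.2.1 i.2.2).toReal * c i

/-- `M.hitProb π g n s` is the probability that `g` is first reached at time exactly `n`, when
`π` is followed from the state `s` at time `0`. -/
noncomputable def hitProb [Fintype S] [DecidableEq S] (M : MDP S A) (π : S → A) (g : S) :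
    ℕ → S → ℝ≥0∞
  | 0, s => if s = g then 1 else 0
  | n + 1, s => if s = g then 0 else ∑ s', M.P s (π s) s' * M.hitProb π g n s'

/-- The expected time at which `g` is first reached from `s` under `π`; it is infinite if `g` is
missed with positive probability. -/
noncomputable def expHit [Fintype S] [DecidableEq S] (M : MDP S A) (π : S → A) (g s : S) : ℝ≥0∞ :=
  (∑' n : ℕ, (n : ℝ≥0∞) * M.hitProb π g n s) + ⊤ * (1 - ∑' n : ℕ, M.hitProb π g n s)

/-- The diameter `max_{s ≠ s'} min_π E[T(s' ∣ π, s)]`. -/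
noncomputable def diam [Fintype S] [DecidableEq S] (M : MDP S A) : ℝ≥0∞ :=
  ⨆ (s : S) (s' : S) (_ : s ≠ s'), ⨅ π : S → A, M.expHit π s' s

/-- An offline planning oracle: given arbitrary real costs for every time step, it returns a best
stationary deterministic policy, ties being broken in an arbitrary (measurable) way. -/
structure PlanningOracle [Fintype S] [Fintype A] [DecidableEq A] (M : MDP S A) (T : ℕ) where
  plan : (Fin T × S × A → ℝ) → (S → A)
  optimal : ∀ c π, M.policyCost c (plan c) ≤ M.policyCost c π
  measurable_plan : ∀ π, MeasurableSet {c | plan c = π}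

end MDP

/-- The centred Laplace distribution with density `(η / 2) exp (-η |x|)`. -/
noncomputable def laplace (η : ℝ) : MeasureTheory.Measure ℝ :=
  MeasureTheory.volume.withDensity fun x => ENNReal.ofReal (η / 2 * Real.exp (-(η * |x|)))

theorem isProbabilityMeasure_laplace {η : ℝ} (hη : 0 < η) :
    MeasureTheory.IsProbabilityMeasure (laplace η) := by
  have hint : MeasureTheory.Integrable (fun x : ℝ => Real.exp (-(η * |x|))) := by
    have h1 : MeasureTheory.IntegrableOn (fun x : ℝ => Real.exp (-(η * |x|))) (Set.Ioi 0) :=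
      (MeasureTheory.integrableOn_congr_fun (fun x hx => by
        simp [abs_of_pos (Set.mem_Ioi.1 hx)]) measurableSet_Ioi).1
        (integrableOn_exp_mul_Ioi (a := -η) (by linarith) 0)
    have h2 : MeasureTheory.IntegrableOn (fun x : ℝ => Real.exp (-(η * |x|))) (Set.Iic 0) :=
      (MeasureTheory.integrableOn_congr_fun (fun x hx => by
        simp [abs_of_nonpos (Set.mem_Iic.1 hx)]) measurableSet_Iic).1
        (integrableOn_exp_mul_Iic hη 0)
    have := h2.union h1
    rwa [Set.Iic_union_Ioi, MeasureTheory.integrableOn_univ] at this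
  constructor
  rw [laplace, MeasureTheory.withDensity_apply _ MeasurableSet.univ,
    MeasureTheory.Measure.restrict_univ,
    ← MeasureTheory.ofReal_integral_eq_lintegral_ofReal (hint.const_mul _)
      (Filter.Eventually.of_forall fun x => by positivity)]
  have h3 : ∫ x : ℝ, Real.exp (-(η * |x|)) = 2 / η := by
    rw [integral_comp_abs (f := fun x => Real.exp (-(η * x)))]
    have := integral_exp_mul_Ioi (a := -η) (by linarith) 0
    simp only [neg_mul] at this
    rw [this]
    simp
    ring
  rw [MeasureTheory.integral_const_mul, h3]
  field_simp
  simp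

/-- A Bernoulli variable with success probability `p` (only used for `p ≤ 1`). -/
noncomputable def coin (p : ℝ≥0∞) : PMF Bool :=
  PMF.ofFintype (fun b => cond b (min p 1) (1 - min p 1)) (by simp)

/-- The learner's input for a horizon of `T` steps: the planning oracle, the Laplace parameter `η`,
the number `J` of epochs, the number `L` of geometric re-samplings, a parking state with its
staying action, the policies `nav s s'` used to travel from `s` to `s'`, and travel times `len g`
from the parking state to `g`. -/
structure FTPL {S A : Type*} [Fintype S] [Fintype A] [DecidableEq A] (M : MDP S A) (T : ℕ) where
  oracle : M.PlanningOracle T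
  η : ℝ
  η_pos : 0 < η
  J : ℕ
  L : ℕ
  park : S
  stay : A
  nav : S → S → S → A
  len : S → ℕ

/-- The configuration during a run: number `t` of steps played so far, current state, loss suffered
so far, loss estimators (zero where nothing has been estimated), number of calls to the planning
oracle so far, and number of scalar random variables drawn by the learner so far. -/
structure RunState (S A : Type*) (T : ℕ) where
  t : ℕ
  s : S
  loss : ℝ
  est : Fin T × S × A → ℝ
  calls : ℕ
  draws : ℕ

namespace FTPL

variable {S A : Type*} [Fintype S] [Fintype A] [DecidableEq S] [DecidableEq A]
  {M : MDP S A} {T : ℕ}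

/-! ### Follow the perturbed leader -/

/-- The law of the policy that the oracle returns for the costs `c + z`, where the entries
`z^t(s, a)`, for all `t < T` and all `(s, a)`, are independent Laplace variables. -/
noncomputable def leader (alg : FTPL M T) (c : Fin T × S × A → ℝ) : PMF (S → A) :=
  PMF.ofFintype
    (fun π => MeasureTheory.Measure.pi (fun _ : Fin T × S × A => laplace alg.η)
      {z | alg.oracle.plan (c + z) = π})
    (by
      have := isProbabilityMeasure_laplace alg.η_pos
      have hm : ∀ π, MeasurableSet {z : Fin T × S × A → ℝ | alg.oracle.plan (c + z) = π} :=
        fun π => (measurable_const_add c) (alg.oracle.measurable_plan π)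
      rw [← MeasureTheory.measure_biUnion_finset
        (fun π _ π' _ h => Set.disjoint_left.2 fun z hz hz' => h (hz.symm.trans hz'))
        (fun π _ => hm π)]
      convert MeasureTheory.measure_univ (μ := MeasureTheory.Measure.pi
        (fun _ : Fin T × S × A => laplace alg.η))
      ext z
      simp)

/-- One step of interaction: the action `a` is played, its loss is suffered, and the state moves.
Nothing happens once the horizon `T` is reached. -/
noncomputable def act (ℓ : ℕ → S → A → ℝ) (a : A) (x : RunState S A T) : PMF (RunState S A T) :=
  if x.t < T then
    (M.P x.s a).map fun s' => { x with t := x.t + 1, s := s', loss := x.loss + ℓ x.t x.s a }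
  else PMF.pure x

/-! ### The policy switching procedure -/

/-- The common travel time `l*` from the parking state. -/
def travelTime (alg : FTPL M T) : ℕ := Finset.univ.sup alg.len

/-- The action of the travel towards `g` when `r` of its `l*` steps remain: stay at the parking
state until `len g` steps remain, then follow `nav park g`. -/
def travelAction (alg : FTPL M T) (g : S) (r : ℕ) (s : S) : A :=
  if alg.len g < r then alg.stay else alg.nav alg.park g s

/-- The law of the state after the last `r` steps of the travel towards `g`, started in `s`. -/
noncomputable def landing (alg : FTPL M T) (g : S) : ℕ → S → PMF S
  | 0, s => PMF.pure s
  | r + 1, s => (M.P s (alg.travelAction g (r + 1) s)).bind (alg.landing g r)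

/-- `p_g`: the probability of being in `g` after the `l*` steps of the travel from the parking
state towards `g`. -/
noncomputable def arriveProb (alg : FTPL M T) (g : S) : ℝ≥0∞ :=
  alg.landing g alg.travelTime alg.park g

/-- Follow `π` until `target` is reached or the horizon, for at most the given number of steps. -/
noncomputable def moveTo (alg : FTPL M T) (ℓ : ℕ → S → A → ℝ) (π : S → A) (target : S) :
    ℕ → RunState S A T → PMF (RunState S A T)
  | 0, x => PMF.pure x
  | n + 1, x =>
      if x.s = target ∨ T ≤ x.t then PMF.pure x
      else (act (M := M) ℓ (π x.s) x).bind (alg.moveTo ℓ π target n)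

/-- Play the last `r` steps of the travel towards `g`. -/
noncomputable def travel (alg : FTPL M T) (ℓ : ℕ → S → A → ℝ) (g : S) :
    ℕ → RunState S A T → PMF (RunState S A T)
  | 0, x => PMF.pure x
  | r + 1, x => (act (M := M) ℓ (alg.travelAction g (r + 1) x.s) x).bind (alg.travel ℓ g r)

/-- Switch to `π`. Repeat: move to the parking state; draw a target `g` from the law that `π` has
at the time of arrival; travel `l*` steps towards `g`; on arrival in `g`, stop with probability
`p* / p_g`, where `p* = min_g p_g`. Each round takes at least one step, so that the fuel `T`
suffices to reach the end of the procedure or the horizon. -/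
noncomputable def switch (alg : FTPL M T) (ℓ : ℕ → S → A → ℝ) (π : S → A) :
    ℕ → RunState S A T → PMF (RunState S A T)
  | 0, x => PMF.pure x
  | n + 1, x =>
      if T ≤ x.t then PMF.pure x
      else
        (alg.moveTo ℓ (alg.nav x.s alg.park) alg.park T x).bind fun y =>
          (M.stateLaw π (y.t + alg.travelTime)).bind fun g =>
            (alg.travel ℓ g alg.travelTime { y with draws := y.draws + 1 }).bind fun w =>
              if w.s = g then
                (coin ((⨅ g', alg.arriveProb g') / alg.arriveProb g)).bind fun b =>
                  if b then PMF.pure { w with draws := w.draws + 1 }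
                  else alg.switch ℓ π n { w with draws := w.draws + 1 }
              else alg.switch ℓ π n w

/-! ### Geometric re-sampling and the epochs -/

/-- The number of trials of geometric re-sampling, when at most `n` trials are allowed: in each
trial a policy `π'` is obtained with a fresh perturbation and a coin with success probability
`μ_{π'}^t(s, a)` is thrown; the procedure ends with the first success or with the last trial. -/
noncomputable def resample (alg : FTPL M T) (c : Fin T × S × A → ℝ) (t : ℕ) (s : S) (a : A) :
    ℕ → PMF ℕ
  | 0 => PMF.pure 0
  | n + 1 =>
      (alg.leader c).bind fun π' =>
        (coin (M.occ π' t s a)).bind fun b =>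
          if b = true ∨ n = 0 then PMF.pure 1 else (alg.resample c t s a n).map (· + 1)

/-- One step after switching: play `π`, observe the loss of the visited pair and the next state,
and record the loss estimator at the visited pair. Here `c` are the loss estimators of the previous
epochs. Each trial of the re-sampling costs one oracle call, the perturbation and one coin. -/
noncomputable def learnStep (alg : FTPL M T) (ℓ : ℕ → S → A → ℝ) (c : Fin T × S × A → ℝ)
    (π : S → A) (x : RunState S A T) : PMF (RunState S A T) :=
  (alg.resample c x.t x.s (π x.s) alg.L).bind fun m =>
    (M.P x.s (π x.s)).map fun s' =>
      { t := x.t + 1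
        s := s'
        loss := x.loss + ℓ x.t x.s (π x.s)
        est := fun i =>
          if (i.1 : ℕ) = x.t ∧ i.2 = (x.s, π x.s) then ℓ x.t x.s (π x.s) * m else x.est i
        calls := x.calls + m
        draws := x.draws + m * (T * Fintype.card S * Fintype.card A + 1) }

/-- Follow `π` as long as the time is less than `tEnd`, for at most `n` steps. -/
noncomputable def follow (alg : FTPL M T) (ℓ : ℕ → S → A → ℝ) (c : Fin T × S × A → ℝ)
    (π : S → A) (tEnd : ℕ) : ℕ → RunState S A T → PMF (RunState S A T)
  | 0, x => PMF.pure x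
  | n + 1, x =>
      if x.t < tEnd then (alg.learnStep ℓ c π x).bind (alg.follow ℓ c π tEnd n) else PMF.pure x

/-- The epoch length `⌈T / J⌉`. -/
noncomputable def epochLength (alg : FTPL M T) : ℕ := ⌈(T : ℝ) / alg.J⌉₊

/-- The epoch number `j` (from `0`): get a new policy with a fresh perturbation, switch to it, and
follow it in the time slots of the epoch that remain. -/
noncomputable def epoch (alg : FTPL M T) (ℓ : ℕ → S → A → ℝ) (j : ℕ) (x : RunState S A T) :
    PMF (RunState S A T) :=
  (alg.leader x.est).bind fun π =>
    (alg.switch ℓ π T { x with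
        calls := x.calls + 1
        draws := x.draws + T * Fintype.card S * Fintype.card A }).bind
      (alg.follow ℓ x.est π (min ((j + 1) * alg.epochLength) T) alg.epochLength)

/-- The law of the configuration after the first `j` epochs. -/
noncomputable def runEpochs (alg : FTPL M T) (ℓ : ℕ → S → A → ℝ) : ℕ → PMF (RunState S A T)
  | 0 => PMF.pure { t := 0, s := M.init, loss := 0, est := 0, calls := 0, draws := 0 }
  | j + 1 => (alg.runEpochs ℓ j).bind (alg.epoch ℓ j)

/-- The law of the configuration at the end of the run. -/
noncomputable def run (alg : FTPL M T) (ℓ : ℕ → S → A → ℝ) : PMF (RunState S A T) :=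
  alg.runEpochs ℓ alg.J

/-- The regret: the learner's expected total loss minus the expected total loss of the best
stationary deterministic policy (the law `run` has finite support). -/
noncomputable def regret (alg : FTPL M T) (ℓ : ℕ → S → A → ℝ) : ℝ :=
  (∑' x, (alg.run ℓ x).toReal * x.loss) -
    ⨅ π : S → A, M.policyCost (fun i : Fin T × S × A => ℓ i.1 i.2.1 i.2.2) π

/-- The learner's input is chosen as prescribed: `park` is a parking state, the travel policies and
times fit the diameter, and `η`, `J`, `L` have the prescribed values (rounded up to integers). -/
structure Tuned (alg : FTPL M T) : Prop where
  parking : M.P alg.park alg.stay alg.park = 1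
  nav_le : ∀ s s', s ≠ s' → M.expHit (alg.nav s s') s' s ≤ M.diam
  len_park : alg.len alg.park = 0
  len_le : ∀ g, g ≠ alg.park → (alg.len g : ℝ≥0∞) ≤ 2 * M.diam
  len_prob : ∀ g, g ≠ alg.park →
    1 / (4 * M.diam) ≤ M.hitProb (alg.nav alg.park g) g (alg.len g) alg.park
  η_eq : alg.η = (Fintype.card S : ℝ) ^ (1 / 3 : ℝ) /
    (M.diam.toReal ^ (2 / 3 : ℝ) * (T : ℝ) ^ (1 / 3 : ℝ))
  J_eq : alg.J = ⌈(Fintype.card S : ℝ) ^ (2 / 3 : ℝ) * (Fintype.card A : ℝ) ^ (1 / 2 : ℝ) *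
    (T : ℝ) ^ (5 / 6 : ℝ) / M.diam.toReal ^ (4 / 3 : ℝ)⌉₊
  L_eq : alg.L = ⌈(Fintype.card S : ℝ) ^ (1 / 3 : ℝ) * (Fintype.card A : ℝ) ^ (1 / 2 : ℝ) *
    (T : ℝ) ^ (1 / 6 : ℝ) / M.diam.toReal ^ (2 / 3 : ℝ)⌉₊

end FTPL

/-! Write Φ(c) = `perturbedMin c` for the mean over the Laplace noise z of min_π ⟨μ_π, c + z⟩, and
q_c = `leaderOcc c` for the mean occupancy of the policy drawn for the costs c. The proof follows
the potential (loss so far) − Φ(estimators) through the epochs. Three facts about Φ carry it. First,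
Φ(c) ≤ ⟨μ_π, c⟩ for every π, because the noise is centred (`perturbedMin_le`). Second, −Φ(0) ≤ (S
log A + 1/2)·2√T/η, by exponential moments (`neg_perturbedMin_zero_le`). Third, Φ(c + d) ≥ Φ(c) + (1
− η‖d‖₁)⟨q_c, d⟩ for d ≥ 0 (`perturbedMin_add_ge`): be-the-leader, together with the fact that
shifting Laplace noise by d changes probabilities by a factor of at most exp(η‖d‖₁).

There are no resets, so a new policy cannot simply be followed from the current state: its occupancy
measure would be wrong. The switching procedure repairs this by rejection sampling. A round with
target g is the last one with probability p_g · (p*/p_g) = p*, whatever g is; hence, given the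
stopping time, the state has exactly the law of π at that time (`Tuned.expect_switch_eq_zero`). A
round takes at most D + l* ≤ 3D steps in expectation and p* ≥ 1/(4D), so a switch costs at most 12D²
steps (`Tuned.expect_switch_t_le`).

After the switch, averaging over the draw of π turns expected nonnegative costs along the epoch into
sums weighted by q_c. The number M of re-sampling trials satisfies q·E[M] = 1 − (1 − q)^L and
q·E[M²] ≤ 2E[M]. Therefore the loss exceeds ⟨q_c, d⟩, where d is the increment of the estimators in
the epoch, only by a truncation bias of at most SA/(L + 1) per slot, and η‖d‖₁⟨q_c, d⟩ contributes
at most η(H + 1)SA per slot (`expect_follow_mul_le`). On the comparator side the estimators never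
exceed the losses in mean, so E[Φ(estimators)] is at most the cost of the best policy.

Altogether the regret is bounded, up to constants, by (S log A + 1)√T/η + J·D² + J·H·(SA/L + ηH·SA).
The prescribed parameters balance these terms when A^{1/2}(SD)^{2/3} ≤ T^{1/6}; otherwise the
claimed bound exceeds T and holds trivially. -/

set_option linter.unusedSectionVars false

/-! ### Expectations under finitely supported laws -/

namespace PMF

variable {α β : Type*}

/-- A probability mass function with finite support. -/
class FinSupp (p : PMF α) : Prop where
  finite : p.support.Finite

/-- These instances let type-class search see that every stage of the algorithm has finite support:
states, policies and coins range over finite types. Interchanging sums then needs no summability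
argument. -/
instance FinSupp.of_finite [Finite α] (p : PMF α) : FinSupp p := ⟨Set.toFinite _⟩

instance FinSupp.pure (a : α) : FinSupp (PMF.pure a) := ⟨by simp⟩

instance FinSupp.bind (p : PMF α) (q : α → PMF β) [hp : FinSupp p] [hq : ∀ a, FinSupp (q a)] :
    FinSupp (p.bind q) :=
  ⟨by rw [support_bind]; exact hp.finite.biUnion fun a _ => (hq a).finite⟩

instance FinSupp.map (p : PMF α) (f : α → β) [hp : FinSupp p] : FinSupp (p.map f) :=
  ⟨by rw [support_map]; exact hp.finite.image f⟩

instance FinSupp.ite (c : Prop) [Decidable c] (p q : PMF α) [hp : FinSupp p] [hq : FinSupp q] :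
    FinSupp (if c then p else q) := by
  split_ifs <;> assumption

/-- The expectation of a real function under a probability mass function. -/
noncomputable def expect (p : PMF α) (f : α → ℝ) : ℝ := ∑' x, (p x).toReal * f x

theorem expect_eq_sum {p : PMF α} {s : Finset α} (h : p.support ⊆ s) (f : α → ℝ) :
    p.expect f = ∑ x ∈ s, (p x).toReal * f x := by
  rw [expect, tsum_eq_sum]
  intro x hx
  have : p x = 0 := by
    by_contra hne
    exact hx (h ((p.mem_support_iff x).2 hne))
  simp [this]

theorem expect_eq_sum_support (p : PMF α) [hp : FinSupp p] (f : α → ℝ) :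
    p.expect f = ∑ x ∈ hp.finite.toFinset, (p x).toReal * f x :=
  expect_eq_sum (by simp) f

theorem expect_fintype [Fintype α] (p : PMF α) (f : α → ℝ) :
    p.expect f = ∑ x, (p x).toReal * f x :=
  expect_eq_sum (by simp) f

theorem sum_toReal_support (p : PMF α) [hp : FinSupp p] :
    ∑ x ∈ hp.finite.toFinset, (p x).toReal = 1 := by
  have h : ∑' x, p x = ∑ x ∈ hp.finite.toFinset, p x :=
    tsum_eq_sum fun x hx => by simpa using hx
  rw [← ENNReal.toReal_sum fun x _ => p.apply_ne_top x, ← h, p.tsum_coe, ENNReal.toReal_one]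

theorem sum_toReal [Fintype α] (p : PMF α) : ∑ x, (p x).toReal = 1 := by
  have h : ∑' x, p x = ∑ x, p x := tsum_fintype _
  rw [← ENNReal.toReal_sum fun x _ => p.apply_ne_top x, ← h, p.tsum_coe, ENNReal.toReal_one]

@[simp] theorem expect_pure (a : α) (f : α → ℝ) : (PMF.pure a).expect f = f a := by
  rw [expect_eq_sum (s := {a}) (by simp)]
  simp

@[simp] theorem expect_const (p : PMF α) [FinSupp p] (c : ℝ) : (p.expect fun _ => c) = c := by
  rw [expect_eq_sum_support, ← Finset.sum_mul, sum_toReal_support, one_mul]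

theorem expect_bind (p : PMF α) (q : α → PMF β) [hp : FinSupp p] [hq : ∀ a, FinSupp (q a)]
    (f : β → ℝ) : (p.bind q).expect f = p.expect fun a => (q a).expect f := by
  classical
  set s := hp.finite.toFinset
  set u := (FinSupp.bind p q).finite.toFinset
  have hps : p.support ⊆ s := by simp [s]
  rw [expect_eq_sum (s := u) (by simp [u]), expect_eq_sum hps]
  have h1 : ∀ a ∈ s, (p a).toReal * (q a).expect f =
      ∑ y ∈ u, (p a).toReal * ((q a y).toReal * f y) := by
    intro a ha
    rw [expect_eq_sum (s := u), Finset.mul_sum]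
    intro y hy
    simp only [u, Set.Finite.coe_toFinset, mem_support_bind_iff]
    exact ⟨a, by simpa [s] using ha, hy⟩
  rw [Finset.sum_congr rfl h1, Finset.sum_comm]
  refine Finset.sum_congr rfl fun y _ => ?_
  rw [bind_apply, tsum_eq_sum (s := s), ENNReal.toReal_sum, Finset.sum_mul]
  · refine Finset.sum_congr rfl fun a _ => ?_
    rw [ENNReal.toReal_mul, mul_assoc]
  · exact fun a _ => ENNReal.mul_ne_top (p.apply_ne_top a) ((q a).apply_ne_top y)
  · intro a ha
    have : p a = 0 := by simpa [s] using ha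
    simp [this]

theorem expect_map (p : PMF α) (g : α → β) [FinSupp p] (f : β → ℝ) :
    (p.map g).expect f = p.expect fun a => f (g a) := by
  have h := expect_bind p (fun a => PMF.pure (g a)) f
  simp only [expect_pure] at h
  rw [← h, ← bind_pure_comp]
  rfl

theorem expect_mono {p : PMF α} [FinSupp p] {f g : α → ℝ} (h : ∀ x ∈ p.support, f x ≤ g x) :
    p.expect f ≤ p.expect g := by
  rw [expect_eq_sum_support, expect_eq_sum_support]
  refine Finset.sum_le_sum fun x hx => ?_
  exact mul_le_mul_of_nonneg_left (h x (by simpa using hx)) ENNReal.toReal_nonneg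

theorem expect_congr {p : PMF α} {f g : α → ℝ} (h : ∀ x ∈ p.support, f x = g x) :
    p.expect f = p.expect g := by
  refine tsum_congr fun x => ?_
  by_cases hx : x ∈ p.support
  · rw [h x hx]
  · rw [(p.apply_eq_zero_iff x).2 hx]
    simp

theorem expect_nonneg {p : PMF α} {f : α → ℝ} (h : ∀ x ∈ p.support, 0 ≤ f x) :
    0 ≤ p.expect f := by
  refine tsum_nonneg fun x => ?_
  by_cases hx : x ∈ p.support
  · exact mul_nonneg ENNReal.toReal_nonneg (h x hx)
  · rw [(p.apply_eq_zero_iff x).2 hx]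
    simp

theorem expect_le_of_le {p : PMF α} [FinSupp p] {f : α → ℝ} {c : ℝ}
    (h : ∀ x ∈ p.support, f x ≤ c) : p.expect f ≤ c :=
  (expect_mono h).trans_eq (expect_const p c)

theorem expect_eq_of_eq {p : PMF α} [FinSupp p] {f : α → ℝ} {c : ℝ}
    (h : ∀ x ∈ p.support, f x = c) : p.expect f = c :=
  (expect_congr h).trans (expect_const p c)

theorem expect_add (p : PMF α) [FinSupp p] (f g : α → ℝ) :
    (p.expect fun x => f x + g x) = p.expect f + p.expect g := by
  simp only [expect_eq_sum_support, ← Finset.sum_add_distrib, mul_add]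

theorem expect_sub (p : PMF α) [FinSupp p] (f g : α → ℝ) :
    (p.expect fun x => f x - g x) = p.expect f - p.expect g := by
  simp only [expect_eq_sum_support, ← Finset.sum_sub_distrib, mul_sub]

theorem expect_const_mul (p : PMF α) (c : ℝ) (f : α → ℝ) :
    (p.expect fun x => c * f x) = c * p.expect f := by
  rw [expect, expect, ← tsum_mul_left]
  exact tsum_congr fun x => by ring

theorem expect_mul_const (p : PMF α) (c : ℝ) (f : α → ℝ) :
    (p.expect fun x => f x * c) = p.expect f * c := by
  simp only [mul_comm _ c, expect_const_mul]

theorem expect_finset_sum {ι : Type*} (p : PMF α) [FinSupp p] (s : Finset ι) (f : ι → α → ℝ) :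
    (p.expect fun x => ∑ i ∈ s, f i x) = ∑ i ∈ s, p.expect (f i) := by
  simp only [expect_eq_sum_support, Finset.mul_sum]
  rw [Finset.sum_comm]

theorem expect_ite (c : Prop) [Decidable c] (p q : PMF α) (f : α → ℝ) :
    (if c then p else q).expect f = if c then p.expect f else q.expect f := by
  split_ifs <;> rfl

end PMF

theorem expect_coin {p : ℝ≥0∞} (hp : p ≤ 1) (f : Bool → ℝ) :
    (coin p).expect f = p.toReal * f true + (1 - p.toReal) * f false := by
  rw [PMF.expect_fintype, Fintype.sum_bool]
  simp only [coin, PMF.ofFintype_apply, cond_true, cond_false, min_eq_left hp]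
  rw [ENNReal.toReal_sub_of_le hp ENNReal.one_ne_top, ENNReal.toReal_one]

namespace PMF

theorem sum_fintype {α : Type*} [Fintype α] (p : PMF α) : ∑ a, p a = 1 := by
  rw [← p.tsum_coe, tsum_fintype]

end PMF

/-! ### Hitting times and the diameter -/

namespace MDP

variable {S A : Type*} [Fintype S] [DecidableEq S]

theorem sum_hitProb_le_one (M : MDP S A) (π : S → A) (g : S) (k : ℕ) (s : S) :
    ∑ n ∈ Finset.range k, M.hitProb π g n s ≤ 1 := by
  induction k generalizing s with
  | zero => simp
  | succ k ih =>
    rw [Finset.sum_range_succ']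
    by_cases h : s = g
    · simp [hitProb, h]
    · simp only [hitProb, h, if_false, add_zero]
      rw [Finset.sum_comm]
      simp only [← Finset.mul_sum]
      calc ∑ s', M.P s (π s) s' * ∑ n ∈ Finset.range k, M.hitProb π g n s'
          ≤ ∑ s', M.P s (π s) s' * 1 := Finset.sum_le_sum fun s' _ => by gcongr; exact ih s'
        _ = 1 := by simp [PMF.sum_fintype]

theorem tsum_hitProb_le_one (M : MDP S A) (π : S → A) (g s : S) :
    ∑' n, M.hitProb π g n s ≤ 1 :=
  ENNReal.tsum_le_of_sum_range_le fun k => M.sum_hitProb_le_one π g k s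

theorem expHit_self (M : MDP S A) (π : S → A) (g : S) : M.expHit π g g = 0 := by
  have h0 : ∀ n, n ≠ 0 → M.hitProb π g n g = 0 := by
    intro n hn
    obtain ⟨m, rfl⟩ := Nat.exists_eq_succ_of_ne_zero hn
    simp [hitProb]
  rw [expHit, tsum_eq_single 0 h0, tsum_eq_single 0 fun n hn => by simp [h0 n hn]]
  simp [hitProb]

/-- First-step analysis. Both parts of `expHit` satisfy it separately: the sum of n times the
hitting probability picks up the hitting mass of the successor, and the mass of never hitting is
averaged over the successors. -/
theorem expHit_of_ne (M : MDP S A) (π : S → A) {g s : S} (hs : s ≠ g) :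
    M.expHit π g s = 1 + ∑ s', M.P s (π s) s' * M.expHit π g s' := by
  have hstep : ∀ n, M.hitProb π g (n + 1) s = ∑ s', M.P s (π s) s' * M.hitProb π g n s' := by
    intro n
    simp [hitProb, hs]
  have hzero : M.hitProb π g 0 s = 0 := by simp [hitProb, hs]
  have hF : ∑' n, M.hitProb π g n s = ∑ s', M.P s (π s) s' * ∑' n, M.hitProb π g n s' := by
    rw [tsum_eq_zero_add' ENNReal.summable, hzero, zero_add]
    simp only [hstep]
    rw [Summable.tsum_finsetSum fun _ _ => ENNReal.summable]
    simp only [ENNReal.tsum_mul_left]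
  have hN : ∑' n : ℕ, (n : ℝ≥0∞) * M.hitProb π g n s =
      ∑ s', M.P s (π s) s' *
        (∑' n : ℕ, (n : ℝ≥0∞) * M.hitProb π g n s' + ∑' n, M.hitProb π g n s') := by
    rw [tsum_eq_zero_add' ENNReal.summable, hzero, mul_zero, zero_add]
    simp only [hstep, Finset.mul_sum]
    rw [Summable.tsum_finsetSum fun _ _ => ENNReal.summable]
    refine Finset.sum_congr rfl fun s' _ => ?_
    rw [← ENNReal.tsum_add, ← ENNReal.tsum_mul_left]
    refine tsum_congr fun n => ?_
    push_cast
    ring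
  have hG : 1 - ∑' n, M.hitProb π g n s =
      ∑ s', M.P s (π s) s' * (1 - ∑' n, M.hitProb π g n s') := by
    refine ENNReal.sub_eq_of_eq_add
      (ne_top_of_le_ne_top ENNReal.one_ne_top (M.tsum_hitProb_le_one π g s)) ?_
    rw [hF, ← Finset.sum_add_distrib, ← PMF.sum_fintype (M.P s (π s))]
    refine Finset.sum_congr rfl fun s' _ => ?_
    rw [← mul_add, PMF.sum_fintype, tsub_add_cancel_of_le (M.tsum_hitProb_le_one π g s'), mul_one]
  have hone : (1 : ℝ≥0∞) = ∑ s', M.P s (π s) s' * 1 := by simp [PMF.sum_fintype]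
  rw [expHit, hN, hG, Finset.mul_sum, ← Finset.sum_add_distrib]
  conv_rhs => rw [hone]
  rw [← Finset.sum_add_distrib]
  refine Finset.sum_congr rfl fun s' _ => ?_
  rw [expHit, mul_left_comm, ← mul_add, ← mul_add]
  congr 1
  -- If `g` is hit almost surely from `s'`, the hitting mass is the 1 of the recursion; otherwise
  -- both sides are infinite.
  rcases (M.tsum_hitProb_le_one π g s').eq_or_lt with h | h
  · rw [h]
    simp [add_comm]
  · rw [ENNReal.top_mul (tsub_pos_of_lt h).ne']
    simp

theorem one_le_expHit (M : MDP S A) (π : S → A) {g s : S} (hs : s ≠ g) :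
    1 ≤ M.expHit π g s := by
  rw [M.expHit_of_ne π hs]
  exact le_self_add

theorem one_le_diam (M : MDP S A) (hS : 2 ≤ Fintype.card S) : 1 ≤ M.diam := by
  obtain ⟨s, s', h⟩ := Fintype.one_lt_card_iff.1 hS
  rw [diam]
  refine le_trans ?_ (le_iSup₂_of_le s s' (le_iSup_of_le h le_rfl))
  exact le_iInf fun π => M.one_le_expHit π h

theorem one_le_diam_toReal {M : MDP S A} (hS : 2 ≤ Fintype.card S) (hD : M.diam ≠ ⊤) :
    1 ≤ M.diam.toReal := by
  have := ENNReal.toReal_mono hD (M.one_le_diam hS)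
  simpa using this

end MDP

/-! ### Travelling from the parking state and the success probability p* -/

namespace FTPL

variable {S A : Type*} [Fintype S] [Fintype A] [DecidableEq S] [DecidableEq A]
  {M : MDP S A} {T : ℕ}

/-- Once at most `len g` steps remain, the travel follows `nav park g`; reaching `g` for the first
time at the last step is one way of ending there. -/
theorem hitProb_le_landing (alg : FTPL M T) (g : S) (r : ℕ) (s : S) (hr : r ≤ alg.len g) :
    M.hitProb (alg.nav alg.park g) g r s ≤ alg.landing g r s g := by
  induction r generalizing s with
  | zero => by_cases h : s = g <;> simp [MDP.hitProb, landing, h]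
  | succ r ih =>
    by_cases h : s = g
    · simp [MDP.hitProb, h]
    · have h2 : alg.travelAction g (r + 1) s = alg.nav alg.park g s := by
        rw [travelAction, if_neg (by omega)]
      simp only [MDP.hitProb, h, if_false, landing, h2, PMF.bind_apply, tsum_fintype]
      exact Finset.sum_le_sum fun s' _ => by gcongr; exact ih s' (by omega)

theorem le_travelTime (alg : FTPL M T) (g : S) : alg.len g ≤ alg.travelTime :=
  Finset.le_sup (f := alg.len) (Finset.mem_univ g)

namespace Tuned

variable {alg : FTPL M T}

/-- `landing` counts the remaining steps, so the extra `k` steps come first; they are spent staying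
at the parking state. -/
theorem landing_park (h : alg.Tuned) (g : S) (k : ℕ) :
    alg.landing g (alg.len g + k) alg.park = alg.landing g (alg.len g) alg.park := by
  induction k with
  | zero => rfl
  | succ k ih =>
    have h1 : M.P alg.park alg.stay = PMF.pure alg.park := by
      ext s
      by_cases hs : s = alg.park
      · simp [hs, h.parking]
      · rw [PMF.pure_apply_of_ne _ _ hs, PMF.apply_eq_zero_iff,
          (PMF.apply_eq_one_iff _ _).1 h.parking]
        simpa using hs
    rw [← add_assoc, landing, travelAction, if_pos (by omega), h1, PMF.pure_bind, ih]

theorem arriveProb_eq (h : alg.Tuned) (g : S) :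
    alg.arriveProb g = alg.landing g (alg.len g) alg.park g := by
  obtain ⟨k, hk⟩ := Nat.exists_eq_add_of_le (alg.le_travelTime g)
  rw [arriveProb, hk, h.landing_park]

theorem inv_le_arriveProb (h : alg.Tuned) (hS : 2 ≤ Fintype.card S) (g : S) :
    1 / (4 * M.diam) ≤ alg.arriveProb g := by
  rw [h.arriveProb_eq]
  by_cases hg : g = alg.park
  · subst hg
    rw [h.len_park]
    simp only [landing, PMF.pure_apply_self]
    refine ENNReal.div_le_of_le_mul ?_
    rw [one_mul]
    calc (1 : ℝ≥0∞) = 1 * 1 := by simp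
      _ ≤ 4 * M.diam := by
        gcongr
        · norm_num
        · exact M.one_le_diam hS
  · exact (h.len_prob g hg).trans (alg.hitProb_le_landing g _ _ le_rfl)

/-- A state other than the parking state cannot be hit at time 0 with the positive probability
1/(4D). Hence every round of the switching procedure before the horizon takes a step, which
justifies the fuel `T` and the charging of draws to steps. -/
theorem one_le_travelTime (h : alg.Tuned) (hS : 2 ≤ Fintype.card S) (hD : M.diam ≠ ⊤) :
    1 ≤ alg.travelTime := by
  obtain ⟨g, hg⟩ := Fintype.exists_ne_of_one_lt_card hS alg.park
  refine le_trans ?_ (alg.le_travelTime g)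
  by_contra hlen
  have h0 : alg.len g = 0 := by omega
  have h1 := h.len_prob g hg
  rw [h0, MDP.hitProb, if_neg hg.symm, nonpos_iff_eq_zero, ENNReal.div_eq_zero_iff] at h1
  rcases h1 with h1 | h1
  · exact one_ne_zero h1
  · exact ENNReal.mul_ne_top (by norm_num) hD h1

theorem travelTime_le (h : alg.Tuned) (hD : M.diam ≠ ⊤) :
    (alg.travelTime : ℝ) ≤ 2 * M.diam.toReal := by
  obtain ⟨g, -, hg⟩ := Finset.exists_mem_eq_sup Finset.univ ⟨alg.park, Finset.mem_univ _⟩ alg.len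
  rw [travelTime, hg]
  by_cases hp : g = alg.park
  · rw [hp, h.len_park]
    simp
  · have := ENNReal.toReal_mono (ENNReal.mul_ne_top (by norm_num) hD) (h.len_le g hp)
    simpa using this

end Tuned

/-- The success probability `p*` of a round of the switching procedure. -/
noncomputable def stopProb (alg : FTPL M T) : ℝ≥0∞ := ⨅ g, alg.arriveProb g

theorem stopProb_le (alg : FTPL M T) (g : S) : alg.stopProb ≤ alg.arriveProb g := iInf_le _ g

theorem arriveProb_le_one (alg : FTPL M T) (g : S) : alg.arriveProb g ≤ 1 := PMF.coe_le_one _ _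

theorem stopProb_le_one (alg : FTPL M T) : alg.stopProb ≤ 1 :=
  (alg.stopProb_le alg.park).trans (alg.arriveProb_le_one _)

theorem Tuned.inv_le_stopProb {alg : FTPL M T} (h : alg.Tuned) (hS : 2 ≤ Fintype.card S) :
    1 / (4 * M.diam.toReal) ≤ alg.stopProb.toReal := by
  have h1 : 1 / (4 * M.diam) ≤ alg.stopProb := le_iInf fun g => h.inv_le_arriveProb hS g
  have h2 := ENNReal.toReal_mono (ne_top_of_le_ne_top ENNReal.one_ne_top alg.stopProb_le_one) h1
  simpa using h2

end FTPL

/-! ### Invariants of the switching procedure that hold on every run -/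

/-- The configuration `y` is reached from `x` by playing only, without any draw or any record. -/
structure RunState.Quiet {S A : Type*} {T : ℕ} (x y : RunState S A T) : Prop where
  t_le : x.t ≤ y.t
  t_le_horizon : x.t ≤ T → y.t ≤ T
  est_eq : y.est = x.est
  calls_eq : y.calls = x.calls
  draws_eq : y.draws = x.draws
  loss_le : y.loss - x.loss ≤ (y.t : ℝ) - x.t

/-- The configuration `y` is reached from `x` by playing, with at most two draws per step and
without any record. -/
structure RunState.Idle {S A : Type*} {T : ℕ} (x y : RunState S A T) : Prop where
  t_le : x.t ≤ y.t
  t_le_horizon : x.t ≤ T → y.t ≤ T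
  est_eq : y.est = x.est
  calls_eq : y.calls = x.calls
  draws_le : y.draws + 2 * x.t ≤ x.draws + 2 * y.t
  loss_le : y.loss - x.loss ≤ (y.t : ℝ) - x.t

namespace RunState

variable {S A : Type*} {T : ℕ} {x y z : RunState S A T}

theorem Quiet.refl (x : RunState S A T) : Quiet x x :=
  ⟨le_rfl, id, rfl, rfl, rfl, by simp⟩

theorem Quiet.trans (h : Quiet x y) (h' : Quiet y z) : Quiet x z :=
  ⟨h.t_le.trans h'.t_le, fun hx => h'.t_le_horizon (h.t_le_horizon hx),
    h'.est_eq.trans h.est_eq, h'.calls_eq.trans h.calls_eq, h'.draws_eq.trans h.draws_eq,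
    by linarith [h.loss_le, h'.loss_le]⟩

theorem Idle.refl (x : RunState S A T) : Idle x x :=
  ⟨le_rfl, id, rfl, rfl, le_rfl, by simp⟩

theorem Idle.trans (h : Idle x y) (h' : Idle y z) : Idle x z :=
  ⟨h.t_le.trans h'.t_le, fun hx => h'.t_le_horizon (h.t_le_horizon hx),
    h'.est_eq.trans h.est_eq, h'.calls_eq.trans h.calls_eq, by linarith [h.draws_le, h'.draws_le],
    by linarith [h.loss_le, h'.loss_le]⟩

end RunState

namespace FTPL

variable {S A : Type*} [Fintype S] [Fintype A] [DecidableEq S] [DecidableEq A]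
  {M : MDP S A} {T : ℕ}

instance (ℓ : ℕ → S → A → ℝ) (a : A) (x : RunState S A T) :
    (act (M := M) ℓ a x).FinSupp := by
  unfold act
  infer_instance

instance finSupp_moveTo (alg : FTPL M T) (ℓ : ℕ → S → A → ℝ) (π : S → A) (g : S) (n : ℕ)
    (x : RunState S A T) : (alg.moveTo ℓ π g n x).FinSupp := by
  induction n generalizing x <;> unfold moveTo <;> infer_instance

instance finSupp_travel (alg : FTPL M T) (ℓ : ℕ → S → A → ℝ) (g : S) (n : ℕ)
    (x : RunState S A T) : (alg.travel ℓ g n x).FinSupp := by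
  induction n generalizing x <;> unfold travel <;> infer_instance

instance finSupp_switch (alg : FTPL M T) (ℓ : ℕ → S → A → ℝ) (π : S → A) (n : ℕ)
    (x : RunState S A T) : (alg.switch ℓ π n x).FinSupp := by
  induction n generalizing x <;> unfold switch <;> infer_instance

section Quiet

variable {ℓ : ℕ → S → A → ℝ}

theorem act_quiet (hℓ : ∀ t s a, ℓ t s a ≤ 1) {a : A} {x y : RunState S A T}
    (hy : y ∈ (act (M := M) ℓ a x).support) : x.Quiet y := by
  unfold act at hy
  split_ifs at hy with ht
  · obtain ⟨s', -, rfl⟩ := (PMF.mem_support_map_iff _ _ _).1 hy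
    refine ⟨by simp, fun _ => ht, rfl, rfl, rfl, ?_⟩
    have := hℓ x.t x.s a
    push_cast
    linarith
  · rw [(PMF.mem_support_pure_iff _ _).1 hy]
    exact .refl x

theorem act_t {a : A} {x y : RunState S A T}
    (hy : y ∈ (act (M := M) ℓ a x).support) (hx : x.t < T) : y.t = x.t + 1 := by
  unfold act at hy
  rw [if_pos hx] at hy
  obtain ⟨s', -, rfl⟩ := (PMF.mem_support_map_iff _ _ _).1 hy
  rfl

theorem moveTo_quiet (alg : FTPL M T) (hℓ : ∀ t s a, ℓ t s a ≤ 1) {π : S → A} {g : S} {n : ℕ}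
    {x y : RunState S A T} (hy : y ∈ (alg.moveTo ℓ π g n x).support) : x.Quiet y := by
  induction n generalizing x with
  | zero =>
    rw [moveTo, PMF.mem_support_pure_iff] at hy
    rw [hy]
    exact .refl x
  | succ n ih =>
    rw [moveTo] at hy
    split_ifs at hy with hs
    · rw [(PMF.mem_support_pure_iff _ _).1 hy]
      exact .refl x
    · obtain ⟨z, hz, hy⟩ := (PMF.mem_support_bind_iff _ _ _).1 hy
      exact (act_quiet hℓ hz).trans (ih hy)

/-- The fuel covers all the steps up to the horizon, and each step advances the time, so running out
of fuel means being at the horizon. -/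
theorem moveTo_end (alg : FTPL M T) {π : S → A} {g : S} {n : ℕ}
    {x y : RunState S A T} (hy : y ∈ (alg.moveTo ℓ π g n x).support) (hn : T ≤ x.t + n) :
    y.s = g ∨ T ≤ y.t := by
  induction n generalizing x with
  | zero =>
    rw [moveTo, PMF.mem_support_pure_iff] at hy
    rw [hy]
    exact .inr hn
  | succ n ih =>
    rw [moveTo] at hy
    split_ifs at hy with hs
    · rw [(PMF.mem_support_pure_iff _ _).1 hy]
      exact hs
    · obtain ⟨z, hz, hy⟩ := (PMF.mem_support_bind_iff _ _ _).1 hy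
      have := act_t hz (by omega)
      exact ih hy (by omega)

theorem travel_quiet (alg : FTPL M T) (hℓ : ∀ t s a, ℓ t s a ≤ 1) {g : S} {n : ℕ}
    {x y : RunState S A T} (hy : y ∈ (alg.travel ℓ g n x).support) : x.Quiet y := by
  induction n generalizing x with
  | zero =>
    rw [travel, PMF.mem_support_pure_iff] at hy
    rw [hy]
    exact .refl x
  | succ n ih =>
    rw [travel] at hy
    obtain ⟨z, hz, hy⟩ := (PMF.mem_support_bind_iff _ _ _).1 hy
    exact (act_quiet hℓ hz).trans (ih hy)

theorem travel_t (alg : FTPL M T) {g : S} {n : ℕ} {x y : RunState S A T}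
    (hy : y ∈ (alg.travel ℓ g n x).support) (hx : x.t ≤ T) : y.t = min (x.t + n) T := by
  induction n generalizing x with
  | zero =>
    rw [travel, PMF.mem_support_pure_iff] at hy
    rw [hy]
    simpa using hx
  | succ n ih =>
    rw [travel] at hy
    obtain ⟨z, hz, hy⟩ := (PMF.mem_support_bind_iff _ _ _).1 hy
    rcases hx.lt_or_eq with h | h
    · have h1 := act_t hz h
      rw [ih hy (by omega), h1]
      congr 1
      omega
    · have h1 : z = x := by
        simpa [act, h] using hz
      rw [ih hy (by rw [h1, h]), h1]
      omega

/-- The configurations at the end of a round of the switching procedure. -/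
theorem round_t (alg : FTPL M T) (hℓ : ∀ t s a, ℓ t s a ≤ 1) (hl : 1 ≤ alg.travelTime) {g : S}
    {π : S → A} {x y w : RunState S A T}
    (hy : y ∈ (alg.moveTo ℓ π alg.park T x).support) {d : ℕ}
    (hw : w ∈ (alg.travel ℓ g alg.travelTime { y with draws := d }).support) (hx : x.t < T) :
    x.t + 1 ≤ w.t := by
  have h1 := (alg.moveTo_quiet hℓ hy).t_le
  have h2 := alg.travel_t hw ((alg.moveTo_quiet hℓ hy).t_le_horizon hx.le)
  have h3 : w.t = min (y.t + alg.travelTime) T := h2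
  omega

/-- A round draws at most two scalars, the target and the coin; both are charged to a step of the
round, which exists by `round_t`. -/
theorem round_idle (alg : FTPL M T) (hℓ : ∀ t s a, ℓ t s a ≤ 1) (hl : 1 ≤ alg.travelTime) {g : S}
    {π : S → A} {x y w : RunState S A T}
    (hy : y ∈ (alg.moveTo ℓ π alg.park T x).support)
    (hw : w ∈ (alg.travel ℓ g alg.travelTime { y with draws := y.draws + 1 }).support)
    (hx : x.t < T) {d : ℕ} (hd : d ≤ w.draws + 1) : x.Idle { w with draws := d } := by
  have h1 := alg.moveTo_quiet hℓ hy
  have h2 := alg.travel_quiet hℓ hw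
  have h3 := alg.round_t hℓ hl hy hw hx
  refine ⟨h1.t_le.trans h2.t_le, fun hx => h2.t_le_horizon (h1.t_le_horizon hx),
    h2.est_eq.trans h1.est_eq, h2.calls_eq.trans h1.calls_eq, ?_, ?_⟩
  · have h4 := h1.draws_eq
    have h5 := h2.draws_eq
    simp only at h5 ⊢
    omega
  · have h4 := h1.loss_le
    have h5 := h2.loss_le
    simp only at h5 ⊢
    linarith

theorem switch_idle (alg : FTPL M T) (hℓ : ∀ t s a, ℓ t s a ≤ 1) (hl : 1 ≤ alg.travelTime)
    {π : S → A} {n : ℕ} {x y : RunState S A T} (hy : y ∈ (alg.switch ℓ π n x).support) :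
    x.Idle y := by
  induction n generalizing x with
  | zero =>
    rw [switch, PMF.mem_support_pure_iff] at hy
    rw [hy]
    exact .refl x
  | succ n ih =>
    rw [switch] at hy
    split_ifs at hy with hx
    · rw [(PMF.mem_support_pure_iff _ _).1 hy]
      exact .refl x
    · obtain ⟨y₁, hy₁, hy⟩ := (PMF.mem_support_bind_iff _ _ _).1 hy
      obtain ⟨g, -, hy⟩ := (PMF.mem_support_bind_iff _ _ _).1 hy
      obtain ⟨w, hw, hy⟩ := (PMF.mem_support_bind_iff _ _ _).1 hy
      have key := fun d hd => alg.round_idle hℓ hl hy₁ hw (not_le.1 hx) (d := d) hd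
      split_ifs at hy with hg
      · obtain ⟨b, -, hy⟩ := (PMF.mem_support_bind_iff _ _ _).1 hy
        split_ifs at hy with hb
        · rw [(PMF.mem_support_pure_iff _ _).1 hy]
          exact key _ le_rfl
        · exact (key _ le_rfl).trans (ih hy)
      · exact (key w.draws (by omega)).trans (ih hy)

end Quiet

/-! ### Expected duration and exit law of the switching procedure -/

section Expectation

variable {ℓ : ℕ → S → A → ℝ}

theorem switch_of_le (alg : FTPL M T) {π : S → A} (n : ℕ) {x : RunState S A T} (hx : T ≤ x.t) :
    alg.switch ℓ π n x = PMF.pure x := by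
  cases n <;> simp [switch, hx]

theorem expect_act {a : A} {x : RunState S A T} (hx : x.t < T) (f : RunState S A T → ℝ) :
    (act (M := M) ℓ a x).expect f = (M.P x.s a).expect fun s' =>
      f { x with t := x.t + 1, s := s', loss := x.loss + ℓ x.t x.s a } := by
  rw [act, if_pos hx, PMF.expect_map]

theorem expect_moveTo_t_le (alg : FTPL M T) (π : S → A) (g : S) (n : ℕ) (x : RunState S A T)
    (hx : M.expHit π g x.s ≠ ⊤) :
    ((alg.moveTo ℓ π g n x).expect fun y => (y.t : ℝ)) ≤ x.t + (M.expHit π g x.s).toReal := by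
  induction n generalizing x with
  | zero => simp [moveTo]
  | succ n ih =>
    rw [moveTo]
    split_ifs with hs
    · simp
    · push Not at hs
      have hrec := M.expHit_of_ne π hs.1
      have hfin : ∀ s', M.P x.s (π x.s) s' * M.expHit π g s' ≠ ⊤ := by
        intro s' h
        refine hx ?_
        rw [hrec, ENNReal.add_eq_top]
        exact .inr (ENNReal.sum_eq_top.2 ⟨s', Finset.mem_univ _, h⟩)
      rw [PMF.expect_bind, expect_act hs.2, PMF.expect_fintype, hrec,
        ENNReal.toReal_add ENNReal.one_ne_top (ENNReal.sum_ne_top.2 fun s' _ => hfin s'),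
        ENNReal.toReal_sum fun s' _ => hfin s', ENNReal.toReal_one, ← add_assoc]
      calc _ ≤ ∑ s', (M.P x.s (π x.s) s').toReal *
            (((x.t : ℝ) + 1) + (M.expHit π g s').toReal) := by
            refine Finset.sum_le_sum fun s' _ => ?_
            -- Successors of probability zero may have infinite expected hitting time, so the
            -- induction hypothesis is not available for them.
            by_cases h0 : M.P x.s (π x.s) s' = 0
            · simp [h0]
            · refine mul_le_mul_of_nonneg_left ?_ ENNReal.toReal_nonneg
              have := ih { x with t := x.t + 1, s := s', loss := x.loss + ℓ x.t x.s (π x.s) }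
                fun h => hfin s' (by
                  simp only at h
                  rw [h, ENNReal.mul_top h0])
              push_cast at this
              exact this
        _ = _ := by
            simp only [mul_add, Finset.sum_add_distrib, ← Finset.sum_mul, PMF.sum_toReal,
              ENNReal.toReal_mul, mul_one, one_mul]

theorem expect_travel (alg : FTPL M T) (g : S) (r : ℕ) (x : RunState S A T) (hx : x.t + r ≤ T)
    (f : S → ℝ) :
    ((alg.travel ℓ g r x).expect fun y => f y.s) = (alg.landing g r x.s).expect f := by
  induction r generalizing x with
  | zero => simp [travel, landing]
  | succ r ih =>
    rw [travel, landing, PMF.expect_bind, PMF.expect_bind, expect_act (by omega)]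
    exact PMF.expect_congr fun s' _ => ih _ (by simp only; omega)

/-- The probability that a round which ends in its target `g` is the last one. -/
noncomputable def acceptProb (alg : FTPL M T) (g : S) : ℝ :=
  (alg.stopProb / alg.arriveProb g).toReal

theorem stopProb_div_le_one (alg : FTPL M T) (g : S) : alg.stopProb / alg.arriveProb g ≤ 1 :=
  ENNReal.div_le_of_le_mul (by rw [one_mul]; exact alg.stopProb_le g)

theorem acceptProb_nonneg (alg : FTPL M T) (g : S) : 0 ≤ alg.acceptProb g :=
  ENNReal.toReal_nonneg

theorem acceptProb_le_one (alg : FTPL M T) (g : S) : alg.acceptProb g ≤ 1 :=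
  ENNReal.toReal_le_of_le_ofReal zero_le_one (by simpa using alg.stopProb_div_le_one g)

/-- This is the point of the coin: the probability of arriving and stopping does not depend on the
target, so conditioning on success does not distort the law from which the target was drawn. -/
theorem arriveProb_mul_acceptProb (alg : FTPL M T) (hp : 0 < alg.stopProb.toReal) (g : S) :
    (alg.arriveProb g).toReal * alg.acceptProb g = alg.stopProb.toReal := by
  rw [acceptProb, ← ENNReal.toReal_mul, ENNReal.mul_div_cancel]
  · exact ((ENNReal.toReal_pos_iff.1 hp).1.trans_le (alg.stopProb_le g)).ne'
  · exact ne_top_of_le_ne_top ENNReal.one_ne_top (alg.arriveProb_le_one g)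

theorem expect_switch_succ (alg : FTPL M T) (π : S → A) (n : ℕ) {x : RunState S A T}
    (hx : x.t < T) (f : RunState S A T → ℝ) :
    (alg.switch ℓ π (n + 1) x).expect f =
      (alg.moveTo ℓ (alg.nav x.s alg.park) alg.park T x).expect fun y =>
        (M.stateLaw π (y.t + alg.travelTime)).expect fun g =>
          (alg.travel ℓ g alg.travelTime { y with draws := y.draws + 1 }).expect fun w =>
            if w.s = g then
              alg.acceptProb g * f { w with draws := w.draws + 1 } + (1 - alg.acceptProb g) *
                (alg.switch ℓ π n { w with draws := w.draws + 1 }).expect f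
            else (alg.switch ℓ π n w).expect f := by
  rw [switch, if_neg (not_le.2 hx), PMF.expect_bind]
  refine PMF.expect_congr fun y _ => ?_
  rw [PMF.expect_bind]
  refine PMF.expect_congr fun g _ => ?_
  rw [PMF.expect_bind]
  refine PMF.expect_congr fun w _ => ?_
  have h1 := expect_coin (alg.stopProb_div_le_one g)
  rw [stopProb] at h1
  rw [PMF.expect_ite, PMF.expect_bind, h1]
  simp [acceptProb, stopProb]

/-- The expected duration of the switching procedure. -/
theorem Tuned.expect_switch_t_le {alg : FTPL M T} (h : alg.Tuned) (hS : 2 ≤ Fintype.card S)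
    (hD : M.diam ≠ ⊤) (hℓ : ∀ t s a, ℓ t s a ≤ 1) (π : S → A) (n : ℕ) (x : RunState S A T)
    (hx : x.t ≤ T) :
    ((alg.switch ℓ π n x).expect fun y => (y.t : ℝ)) ≤
      x.t + 3 * M.diam.toReal / alg.stopProb.toReal := by
  have hD1 := MDP.one_le_diam_toReal hS hD
  have hp1 : alg.stopProb.toReal ≤ 1 :=
    ENNReal.toReal_le_of_le_ofReal zero_le_one (by simpa using alg.stopProb_le_one)
  have hp : 0 < alg.stopProb.toReal := lt_of_lt_of_le (by positivity) (h.inv_le_stopProb hS)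
  set D := M.diam.toReal
  set p := alg.stopProb.toReal
  -- `K` solves K = 3D + (1 − p)K: a round costs at most D + l* ≤ 3D in expectation, and with
  -- probability 1 − p everything starts again.
  set K := 3 * D / p with hK
  have hKp : K * p = 3 * D := by rw [hK]; field_simp
  have hK3 : 3 * D ≤ K := by
    rw [hK, le_div_iff₀ hp]
    nlinarith
  have hl := h.travelTime_le hD
  induction n generalizing x with
  | zero => simp [switch]; linarith
  | succ n ih =>
    rcases hx.lt_or_eq with hx' | hx'
    swap
    · rw [switch_of_le _ _ hx'.ge]
      simp
      linarith
    rw [alg.expect_switch_succ π n hx']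
    have hmove : ((alg.moveTo ℓ (alg.nav x.s alg.park) alg.park T x).expect fun y => (y.t : ℝ)) ≤
        x.t + D := by
      have hnav : M.expHit (alg.nav x.s alg.park) alg.park x.s ≤ M.diam := by
        by_cases hs : x.s = alg.park
        · rw [hs, MDP.expHit_self]
          exact zero_le
        · exact h.nav_le _ _ hs
      refine (alg.expect_moveTo_t_le _ _ T x (ne_top_of_le_ne_top hD hnav)).trans ?_
      gcongr
      exact ENNReal.toReal_mono hD hnav
    suffices hround : ∀ y ∈ (alg.moveTo ℓ (alg.nav x.s alg.park) alg.park T x).support,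
        _ ≤ (y.t : ℝ) + (K - D) by
      refine (PMF.expect_mono hround).trans ?_
      rw [PMF.expect_add, PMF.expect_const]
      linarith
    intro y hy
    have hyT := (alg.moveTo_quiet hℓ hy).t_le_horizon hx
    refine PMF.expect_le_of_le fun g _ => ?_
    -- If the travel is cut off by the horizon, the procedure ends at `T`, which is at most l* ≤ 2D
    -- ≤ K − D steps away.
    by_cases hlate : T ≤ y.t + alg.travelTime
    · refine PMF.expect_le_of_le fun w hw => ?_
      have hwT : w.t = T := by
        rw [alg.travel_t hw hyT]
        exact min_eq_right hlate
      rw [alg.switch_of_le n hwT.ge, alg.switch_of_le n (x := { w with draws := w.draws + 1 }) hwT.ge]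
      simp only [PMF.expect_pure, hwT]
      have : (T : ℝ) ≤ y.t + alg.travelTime := by exact_mod_cast hlate
      split_ifs <;> linarith
    · push Not at hlate
      by_cases hy' : T ≤ y.t
      · omega
      have hpark : y.s = alg.park := (alg.moveTo_end hy (by omega)).resolve_right hy'
      calc _ ≤ (alg.travel ℓ g alg.travelTime { y with draws := y.draws + 1 }).expect fun w =>
            ((y.t : ℝ) + alg.travelTime + K) - K * alg.acceptProb g * (if w.s = g then 1 else 0) := by
            refine PMF.expect_mono fun w hw => ?_
            have hwt : w.t = y.t + alg.travelTime := by
              rw [alg.travel_t hw hyT]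
              exact min_eq_left hlate.le
            have hwt' : (w.t : ℝ) = y.t + alg.travelTime := by exact_mod_cast hwt
            have h1 := ih w (by omega)
            have h2 := ih { w with draws := w.draws + 1 } (by simp only; omega)
            have h3 := alg.acceptProb_le_one g
            have h4 := alg.acceptProb_nonneg g
            simp only [hwt'] at h1 h2 ⊢
            split_ifs
            · nlinarith
            · linarith
        _ = (y.t : ℝ) + alg.travelTime + K - K * p := by
            rw [PMF.expect_sub, PMF.expect_const, PMF.expect_const_mul,
              alg.expect_travel g _ _ (by simp only; omega) (fun s => if s = g then (1 : ℝ) else 0)]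
            have : (alg.landing g alg.travelTime y.s).expect
                (fun s => if s = g then (1 : ℝ) else 0) = (alg.arriveProb g).toReal := by
              rw [PMF.expect_fintype, hpark, arriveProb]
              simp
            rw [this, mul_assoc, mul_comm (alg.acceptProb g), alg.arriveProb_mul_acceptProb hp]
        _ ≤ _ := by linarith

/-- Given the time at which the switching procedure to `π` stops, the state has the law that `π`
has at this time. -/
theorem Tuned.expect_switch_eq_zero {alg : FTPL M T} (h : alg.Tuned) (hS : 2 ≤ Fintype.card S)
    (hD : M.diam ≠ ⊤) (hℓ : ∀ t s a, ℓ t s a ≤ 1) (π : S → A) (f : ℕ → S → ℝ)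
    (hf : ∀ t < T, (M.stateLaw π t).expect (f t) = 0) (hfT : ∀ t s, T ≤ t → f t s = 0)
    (n : ℕ) (x : RunState S A T) (hx : x.t ≤ T) (hn : T ≤ x.t + n) :
    ((alg.switch ℓ π n x).expect fun y => f y.t y.s) = 0 := by
  have hD1 := MDP.one_le_diam_toReal hS hD
  have hp : 0 < alg.stopProb.toReal := lt_of_lt_of_le (by positivity) (h.inv_le_stopProb hS)
  have hl := h.one_le_travelTime hS hD
  induction n generalizing x with
  | zero => simpa [switch] using hfT _ _ hn
  | succ n ih =>
    rcases hx.lt_or_eq with hx' | hx'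
    swap
    · rw [switch_of_le _ _ hx'.ge]
      simpa using hfT _ _ hx'.ge
    rw [alg.expect_switch_succ π n hx']
    refine PMF.expect_eq_of_eq fun y hy => ?_
    have hyT := (alg.moveTo_quiet hℓ hy).t_le_horizon hx
    -- A round cut off by the horizon ends at time `T`, where `f` vanishes.
    by_cases hlate : T ≤ y.t + alg.travelTime
    · refine PMF.expect_eq_of_eq fun g _ => PMF.expect_eq_of_eq fun w hw => ?_
      have hwT : w.t = T := by
        rw [alg.travel_t hw hyT]
        exact min_eq_right hlate
      rw [alg.switch_of_le n hwT.ge, alg.switch_of_le n (x := { w with draws := w.draws + 1 }) hwT.ge]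
      simp [hfT w.t _ hwT.ge]
    · push Not at hlate
      have hpark : y.s = alg.park := (alg.moveTo_end hy (by omega)).resolve_right (by omega)
      -- Given `y`, a successful round ends at the fixed time `y.t + l*`, and its target has the law
      -- of `π` at this time; success has the same probability for all targets, so the contribution
      -- is p* times a mean that vanishes.
      calc _ = (M.stateLaw π (y.t + alg.travelTime)).expect fun g =>
            alg.stopProb.toReal * f (y.t + alg.travelTime) g := ?_
        _ = 0 := by rw [PMF.expect_const_mul, hf _ hlate, mul_zero]
      refine PMF.expect_congr fun g _ => ?_
      calc _ = (alg.travel ℓ g alg.travelTime { y with draws := y.draws + 1 }).expect fun w =>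
            (if w.s = g then 1 else 0) * (alg.acceptProb g * f (y.t + alg.travelTime) g) := by
            refine PMF.expect_congr fun w hw => ?_
            have hwt : w.t = y.t + alg.travelTime := by
              rw [alg.travel_t hw hyT]
              exact min_eq_left hlate.le
            have hwx := (alg.moveTo_quiet hℓ hy).t_le
            -- Failed rounds contribute zero by induction. The round has advanced the time by at
            -- least l* ≥ 1, which pays for the lost unit of fuel.
            have h1 := ih w (by omega) (by omega)
            have h2 := ih { w with draws := w.draws + 1 } (by simp only; omega)
              (by simp only; omega)
            rw [h1, h2]
            split_ifs with hg
            · simp [hwt, hg]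
            · simp
        _ = _ := by
            rw [PMF.expect_mul_const,
              alg.expect_travel g _ _ (by simp only; omega) (fun s => if s = g then (1 : ℝ) else 0),
              ← mul_assoc]
            have : (alg.landing g alg.travelTime y.s).expect
                (fun s => if s = g then (1 : ℝ) else 0) = (alg.arriveProb g).toReal := by
              rw [PMF.expect_fintype, hpark, arriveProb]
              simp
            rw [this, alg.arriveProb_mul_acceptProb hp]

end Expectation

end FTPL

/-! ### Path sums, occupancies and the bias of re-sampling -/

/-- q times the geometric sum of (1 − q)^i over i ≤ n is at most 1, and its n + 1 terms are all at
least (1 − q)^n. This bounds the bias caused by truncating the re-sampling, weighted by the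
probability of a visit. -/
theorem mul_one_sub_pow_le {q : ℝ} (h0 : 0 ≤ q) (h1 : q ≤ 1) (n : ℕ) :
    q * (1 - q) ^ n ≤ 1 / (n + 1) := by
  have hq : 0 ≤ 1 - q := by linarith
  have h := mul_neg_geom_sum (1 - q) (n + 1)
  have h2 : ((n + 1 : ℕ) : ℝ) * (1 - q) ^ n ≤ ∑ i ∈ Finset.range (n + 1), (1 - q) ^ i := by
    have := Finset.card_nsmul_le_sum (Finset.range (n + 1)) (fun i => (1 - q) ^ i) ((1 - q) ^ n)
      fun i hi => pow_le_pow_of_le_one hq (by linarith) (Nat.lt_succ_iff.1 (Finset.mem_range.1 hi))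
    simpa using this
  rw [le_div_iff₀ (by positivity)]
  push_cast at h2
  have h3 : 0 ≤ (1 - q) ^ (n + 1) := by positivity
  nlinarith

/-- The total of the costs `c`, weighted by `w`. -/
noncomputable def pairing {S A : Type*} [Fintype S] [Fintype A] {T : ℕ} (w : ℕ → S → A → ℝ)
    (c : Fin T × S × A → ℝ) : ℝ :=
  ∑ i : Fin T × S × A, w i.1 i.2.1 i.2.2 * c i

namespace MDP

variable {S A : Type*} [Fintype S] [Fintype A] [DecidableEq A]

theorem policyCost_eq_pairing (M : MDP S A) {T : ℕ} (c : Fin T × S × A → ℝ) (π : S → A) :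
    M.policyCost c π = pairing (fun t s a => (M.occ π t s a).toReal) c := rfl

theorem occ_le_one (M : MDP S A) (π : S → A) (t : ℕ) (s : S) (a : A) : M.occ π t s a ≤ 1 := by
  rw [occ]
  split_ifs
  · exact PMF.coe_le_one _ _
  · exact zero_le_one

theorem occ_toReal_le_one (M : MDP S A) (π : S → A) (t : ℕ) (s : S) (a : A) :
    (M.occ π t s a).toReal ≤ 1 :=
  ENNReal.toReal_le_of_le_ofReal zero_le_one (by simpa using M.occ_le_one π t s a)

theorem expect_stateLaw (M : MDP S A) (π : S → A) (t : ℕ) (κ : S → A → ℝ) :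
    (M.stateLaw π t).expect (fun s => κ s (π s)) =
      ∑ s, ∑ a, (M.occ π t s a).toReal * κ s a := by
  rw [PMF.expect_fintype]
  refine Finset.sum_congr rfl fun s _ => ?_
  rw [Finset.sum_eq_single (π s)]
  · simp [occ]
  · intro a _ ha
    simp [occ, ha]
  · simp

/-- The expected total of the costs `κ` along at most `n` steps of `π` from `s` at time `t`,
before time `tEnd`. -/
noncomputable def pathSum (M : MDP S A) (π : S → A) (tEnd : ℕ) (κ : ℕ → S → A → ℝ) :
    ℕ → ℕ → S → ℝ
  | 0, _, _ => 0
  | n + 1, t, s =>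
      if t < tEnd then κ t s (π s) + (M.P s (π s)).expect (M.pathSum π tEnd κ n (t + 1)) else 0

theorem pathSum_nonneg (M : MDP S A) (π : S → A) (tEnd : ℕ) {κ : ℕ → S → A → ℝ}
    (hκ : ∀ t s a, 0 ≤ κ t s a) (n t : ℕ) (s : S) : 0 ≤ M.pathSum π tEnd κ n t s := by
  induction n generalizing t s with
  | zero => simp [pathSum]
  | succ n ih =>
    rw [pathSum]
    split_ifs
    · exact add_nonneg (hκ _ _ _) (PMF.expect_nonneg fun s' _ => ih _ _)
    · rfl

/-- A start drawn from the law of `π` at time `t` keeps the law of `π` at all later times. Only an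
inequality holds because the fuel `n` may end before `tEnd`; nonnegative costs make this harmless.
-/
theorem expect_pathSum_le (M : MDP S A) (π : S → A) (tEnd : ℕ) {κ : ℕ → S → A → ℝ}
    (hκ : ∀ t s a, 0 ≤ κ t s a) (n t : ℕ) :
    (M.stateLaw π t).expect (M.pathSum π tEnd κ n t) ≤
      ∑ i ∈ Finset.Ico t tEnd, (M.stateLaw π i).expect fun s => κ i s (π s) := by
  induction n generalizing t with
  | zero =>
    simp only [pathSum, PMF.expect_const]
    exact Finset.sum_nonneg fun i _ => PMF.expect_nonneg fun s _ => hκ _ _ _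
  | succ n ih =>
    by_cases ht : t < tEnd
    · simp only [pathSum, ht, if_true]
      rw [PMF.expect_add, Finset.sum_eq_sum_Ico_succ_bot ht]
      gcongr
      have := ih (t + 1)
      rw [stateLaw, PMF.expect_bind] at this
      exact this
    · simp only [pathSum, ht, if_false, PMF.expect_const]
      exact Finset.sum_nonneg fun i _ => PMF.expect_nonneg fun s _ => hκ _ _ _

end MDP

namespace FTPL

variable {S A : Type*} [Fintype S] [Fintype A] [DecidableEq S] [DecidableEq A]
  {M : MDP S A} {T : ℕ}

/-- The probability that the policy obtained for the costs `c` visits `(s, a)` at time `t`. -/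
noncomputable def leaderOcc (alg : FTPL M T) (c : Fin T × S × A → ℝ) (t : ℕ) (s : S) (a : A) : ℝ :=
  (alg.leader c).expect fun π => (M.occ π t s a).toReal

theorem leaderOcc_nonneg (alg : FTPL M T) (c : Fin T × S × A → ℝ) (t : ℕ) (s : S) (a : A) :
    0 ≤ alg.leaderOcc c t s a :=
  PMF.expect_nonneg fun _ _ => ENNReal.toReal_nonneg

theorem leaderOcc_le_one (alg : FTPL M T) (c : Fin T × S × A → ℝ) (t : ℕ) (s : S) (a : A) :
    alg.leaderOcc c t s a ≤ 1 :=
  PMF.expect_le_of_le fun _ _ => M.occ_toReal_le_one _ _ _ _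

theorem pairing_leaderOcc (alg : FTPL M T) (c d : Fin T × S × A → ℝ) :
    pairing (alg.leaderOcc c) d = (alg.leader c).expect (M.policyCost d) := by
  simp only [pairing, leaderOcc, ← PMF.expect_mul_const]
  rw [← PMF.expect_finset_sum]
  rfl

theorem expect_leader_stateLaw (alg : FTPL M T) (c : Fin T × S × A → ℝ) (t : ℕ)
    (κ : S → A → ℝ) :
    ((alg.leader c).expect fun π => (M.stateLaw π t).expect fun s => κ s (π s)) =
      ∑ s, ∑ a, alg.leaderOcc c t s a * κ s a := by
  simp only [M.expect_stateLaw, PMF.expect_finset_sum, PMF.expect_mul_const, leaderOcc]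

/-! ### Geometric re-sampling -/

instance finSupp_resample (alg : FTPL M T) (c : Fin T × S × A → ℝ) (t : ℕ) (s : S) (a : A)
    (n : ℕ) : (alg.resample c t s a n).FinSupp := by
  induction n <;> unfold resample <;> infer_instance

theorem resample_le (alg : FTPL M T) {c : Fin T × S × A → ℝ} {t : ℕ} {s : S} {a : A} {n m : ℕ}
    (hm : m ∈ (alg.resample c t s a n).support) : m ≤ n := by
  induction n generalizing m with
  | zero =>
    rw [resample, PMF.mem_support_pure_iff] at hm
    exact hm.le
  | succ n ih =>
    rw [resample] at hm
    obtain ⟨π', -, hm⟩ := (PMF.mem_support_bind_iff _ _ _).1 hm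
    obtain ⟨b, -, hm⟩ := (PMF.mem_support_bind_iff _ _ _).1 hm
    split_ifs at hm
    · rw [(PMF.mem_support_pure_iff _ _).1 hm]
      omega
    · obtain ⟨k, hk, rfl⟩ := (PMF.mem_support_map_iff _ _ _).1 hm
      have := ih hk
      omega

theorem expect_resample_succ (alg : FTPL M T) (c : Fin T × S × A → ℝ) (t : ℕ) (s : S) (a : A)
    (n : ℕ) (f : ℕ → ℝ) :
    (alg.resample c t s a (n + 1)).expect f = alg.leaderOcc c t s a * f 1 +
      (1 - alg.leaderOcc c t s a) * (alg.resample c t s a n).expect fun m => f (m + 1) := by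
  -- The last trial counts as 1 whatever its coin shows; this agrees with a failure followed by zero
  -- further trials, so one recursion covers both cases.
  have h0 : n = 0 → ((alg.resample c t s a n).expect fun m => f (m + 1)) = f 1 := by
    rintro rfl
    simp [resample]
  rw [resample, PMF.expect_bind]
  set e := (alg.resample c t s a n).expect fun m => f (m + 1)
  have h1 : ∀ π', ((coin (M.occ π' t s a)).bind fun b =>
      if b = true ∨ n = 0 then PMF.pure 1 else (alg.resample c t s a n).map (· + 1)).expect f =
      (M.occ π' t s a).toReal * (f 1 - e) + e := by
    intro π'
    rw [PMF.expect_bind, expect_coin (M.occ_le_one _ _ _ _)]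
    by_cases hn : n = 0
    · simp only [hn, or_true, if_true, PMF.expect_pure]
      rw [h0 hn]
      ring
    · simp only [hn, or_false, if_true, PMF.expect_pure, Bool.false_eq_true, if_false,
        PMF.expect_map]
      ring
  simp only [h1]
  rw [PMF.expect_add, PMF.expect_mul_const, PMF.expect_const]
  change alg.leaderOcc c t s a * (f 1 - e) + e = _
  ring

/-- The expected number of trials of geometric re-sampling. -/
noncomputable def trials (alg : FTPL M T) (c : Fin T × S × A → ℝ) (n t : ℕ) (s : S) (a : A) : ℝ :=
  (alg.resample c t s a n).expect fun m => (m : ℝ)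

theorem trials_nonneg (alg : FTPL M T) (c : Fin T × S × A → ℝ) (n t : ℕ) (s : S) (a : A) :
    0 ≤ alg.trials c n t s a :=
  PMF.expect_nonneg fun _ _ => Nat.cast_nonneg _

theorem trials_succ (alg : FTPL M T) (c : Fin T × S × A → ℝ) (n t : ℕ) (s : S) (a : A) :
    alg.trials c (n + 1) t s a = 1 + (1 - alg.leaderOcc c t s a) * alg.trials c n t s a := by
  rw [trials, expect_resample_succ]
  push_cast
  rw [PMF.expect_add, PMF.expect_const, ← trials]
  ring

/-- The mean of a truncated geometric variable, multiplied by the success probability so that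
probability zero needs no separate case. -/
theorem leaderOcc_mul_trials (alg : FTPL M T) (c : Fin T × S × A → ℝ) (n t : ℕ) (s : S) (a : A) :
    alg.leaderOcc c t s a * alg.trials c n t s a = 1 - (1 - alg.leaderOcc c t s a) ^ n := by
  induction n with
  | zero => simp [trials, resample]
  | succ n ih =>
    rw [trials_succ, pow_succ]
    linear_combination (1 - alg.leaderOcc c t s a) * ih

theorem leaderOcc_mul_trials_le (alg : FTPL M T) (c : Fin T × S × A → ℝ) (n t : ℕ) (s : S)
    (a : A) : alg.leaderOcc c t s a * alg.trials c n t s a ≤ 1 := by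
  rw [leaderOcc_mul_trials]
  have : 0 ≤ (1 - alg.leaderOcc c t s a) ^ n :=
    pow_nonneg (by linarith [alg.leaderOcc_le_one c t s a]) n
  linarith

/-- A geometric variable has q·E[M²] = (2 − q)/q ≤ 2E[M]; the truncated version follows by induction
on the number of trials. It controls the diagonal terms in `expect_follow_mul_le`. -/
theorem leaderOcc_mul_expect_sq_le (alg : FTPL M T) (c : Fin T × S × A → ℝ) (n t : ℕ) (s : S)
    (a : A) : (alg.leaderOcc c t s a * (alg.resample c t s a n).expect fun m => (m : ℝ) ^ 2) ≤
      2 * alg.trials c n t s a := by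
  induction n with
  | zero => simp [trials, resample]
  | succ n ih =>
    have h0 := alg.leaderOcc_nonneg c t s a
    have h1 := alg.leaderOcc_le_one c t s a
    have h2 := alg.leaderOcc_mul_trials_le c n t s a
    have h3 : ((alg.resample c t s a n).expect fun m => ((m + 1 : ℕ) : ℝ) ^ 2) =
        ((alg.resample c t s a n).expect fun m => (m : ℝ) ^ 2) + 2 * alg.trials c n t s a + 1 := by
      rw [trials, ← PMF.expect_const_mul, ← PMF.expect_add]
      conv_rhs => rw [← PMF.expect_const (alg.resample c t s a n) 1, ← PMF.expect_add]
      refine PMF.expect_congr fun m _ => ?_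
      push_cast
      ring
    rw [expect_resample_succ, h3, trials_succ]
    set q := alg.leaderOcc c t s a
    set r := alg.trials c n t s a
    set e := (alg.resample c t s a n).expect fun m => (m : ℝ) ^ 2
    push_cast
    nlinarith [mul_le_mul_of_nonneg_left ih (sub_nonneg.2 h1),
      mul_le_mul_of_nonneg_left h2 (sub_nonneg.2 h1)]

/-! ### Following a policy -/

instance finSupp_learnStep (alg : FTPL M T) (ℓ : ℕ → S → A → ℝ) (c : Fin T × S × A → ℝ)
    (π : S → A) (x : RunState S A T) : (alg.learnStep ℓ c π x).FinSupp := by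
  unfold learnStep
  infer_instance

instance finSupp_follow (alg : FTPL M T) (ℓ : ℕ → S → A → ℝ) (c : Fin T × S × A → ℝ)
    (π : S → A) (tEnd n : ℕ) (x : RunState S A T) : (alg.follow ℓ c π tEnd n x).FinSupp := by
  induction n generalizing x <;> unfold follow <;> infer_instance

end FTPL

/-! ### Losses and estimators while a policy is followed -/

/-- Nothing has been estimated for the future. -/
def RunState.Fresh {S A : Type*} {T : ℕ} (x : RunState S A T) : Prop :=
  ∀ i, x.t ≤ (i.1 : ℕ) → x.est i = 0

/-- The configuration `y` is reached from `x` by following a policy before the time `tEnd`, with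
`L` re-samplings. -/
structure RunState.Learns {S A : Type*} [Fintype S] [Fintype A] {T : ℕ} (L tEnd : ℕ)
    (x y : RunState S A T) : Prop where
  t_le : x.t ≤ y.t
  t_le_end : y.t ≤ max x.t tEnd
  fresh : x.Fresh → y.Fresh
  est_le : x.Fresh → ∀ i, x.est i ≤ y.est i
  calls_le : y.calls + x.t * L ≤ x.calls + y.t * L
  draws_le : y.draws + x.t * (L * (T * Fintype.card S * Fintype.card A + 1)) ≤
    x.draws + y.t * (L * (T * Fintype.card S * Fintype.card A + 1))
  loss_le : y.loss - x.loss ≤ (y.t : ℝ) - x.t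

namespace RunState

variable {S A : Type*} [Fintype S] [Fintype A] {T L tEnd : ℕ} {x y z : RunState S A T}

theorem Learns.refl (x : RunState S A T) : Learns L tEnd x x :=
  ⟨le_rfl, le_max_left _ _, id, fun _ _ => le_rfl, le_rfl, le_rfl, by simp⟩

theorem Learns.trans (h : Learns L tEnd x y) (h' : Learns L tEnd y z) : Learns L tEnd x z := by
  refine ⟨h.t_le.trans h'.t_le, ?_, fun hx => h'.fresh (h.fresh hx),
    fun hx i => (h.est_le hx i).trans (h'.est_le (h.fresh hx) i), ?_, ?_, ?_⟩
  · have := h.t_le_end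
    have := h'.t_le_end
    omega
  · linarith [h.calls_le, h'.calls_le]
  · linarith [h.draws_le, h'.draws_le]
  · linarith [h.loss_le, h'.loss_le]

end RunState

namespace FTPL

variable {S A : Type*} [Fintype S] [Fintype A] [DecidableEq S] [DecidableEq A]
  {M : MDP S A} {T : ℕ} {ℓ : ℕ → S → A → ℝ}

/-- The configuration after a step of `learnStep` with `m` trials and the next state `s'`. -/
noncomputable def learnNext (ℓ : ℕ → S → A → ℝ) (π : S → A) (x : RunState S A T)
    (m : ℕ) (s' : S) : RunState S A T where
  t := x.t + 1
  s := s'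
  loss := x.loss + ℓ x.t x.s (π x.s)
  est := fun i =>
    if (i.1 : ℕ) = x.t ∧ i.2 = (x.s, π x.s) then ℓ x.t x.s (π x.s) * m else x.est i
  calls := x.calls + m
  draws := x.draws + m * (T * Fintype.card S * Fintype.card A + 1)

theorem expect_learnStep (alg : FTPL M T) (c : Fin T × S × A → ℝ) (π : S → A)
    (x : RunState S A T) (f : RunState S A T → ℝ) :
    (alg.learnStep ℓ c π x).expect f = (alg.resample c x.t x.s (π x.s) alg.L).expect fun m =>
      (M.P x.s (π x.s)).expect fun s' => f (learnNext ℓ π x m s') := by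
  rw [learnStep, PMF.expect_bind]
  refine PMF.expect_congr fun m _ => ?_
  rw [PMF.expect_map]
  rfl

theorem mem_support_learnStep (alg : FTPL M T) {c : Fin T × S × A → ℝ} {π : S → A}
    {x y : RunState S A T} (hy : y ∈ (alg.learnStep ℓ c π x).support) :
    ∃ m ≤ alg.L, ∃ s', y = learnNext ℓ π x m s' := by
  obtain ⟨m, hm, hy⟩ := (PMF.mem_support_bind_iff _ _ _).1 hy
  obtain ⟨s', -, rfl⟩ := (PMF.mem_support_map_iff _ _ _).1 hy
  exact ⟨m, alg.resample_le hm, s', rfl⟩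

theorem learnNext_learns (hℓ : ∀ t s a, ℓ t s a ∈ Set.Icc (0 : ℝ) 1) (π : S → A)
    (x : RunState S A T) {m L : ℕ} (hm : m ≤ L) (s' : S) {tEnd : ℕ} (ht : x.t < tEnd) :
    x.Learns L tEnd (learnNext ℓ π x m s') := by
  have h1 := hℓ x.t x.s (π x.s)
  refine ⟨?_, ?_, ?_, ?_, ?_, ?_, ?_⟩ <;> simp only [learnNext, RunState.Fresh]
  · omega
  · omega
  · intro hx i hi
    rw [if_neg (by omega), hx i (by omega)]
  · intro hx i
    split_ifs with h
    · rw [hx i h.1.ge]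
      exact mul_nonneg h1.1 (Nat.cast_nonneg _)
    · rfl
  · nlinarith
  · nlinarith [Nat.mul_le_mul_right (T * Fintype.card S * Fintype.card A + 1) hm]
  · push_cast
    linarith [h1.2]

theorem follow_learns (alg : FTPL M T) (hℓ : ∀ t s a, ℓ t s a ∈ Set.Icc (0 : ℝ) 1)
    {c : Fin T × S × A → ℝ} {π : S → A} {tEnd n : ℕ} {x y : RunState S A T}
    (hy : y ∈ (alg.follow ℓ c π tEnd n x).support) : x.Learns alg.L tEnd y := by
  induction n generalizing x with
  | zero =>
    rw [follow, PMF.mem_support_pure_iff] at hy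
    rw [hy]
    exact .refl x
  | succ n ih =>
    rw [follow] at hy
    split_ifs at hy with ht
    · obtain ⟨z, hz, hy⟩ := (PMF.mem_support_bind_iff _ _ _).1 hy
      obtain ⟨m, hm, s', rfl⟩ := alg.mem_support_learnStep hz
      exact (learnNext_learns hℓ π x hm s' ht).trans (ih hy)
    · rw [(PMF.mem_support_pure_iff _ _).1 hy]
      exact .refl x

theorem follow_end (alg : FTPL M T) {c : Fin T × S × A → ℝ} {π : S → A} {tEnd n : ℕ}
    {x y : RunState S A T} (hy : y ∈ (alg.follow ℓ c π tEnd n x).support) (hn : tEnd ≤ x.t + n) :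
    tEnd ≤ y.t := by
  induction n generalizing x with
  | zero =>
    rw [follow, PMF.mem_support_pure_iff] at hy
    rw [hy]
    exact hn
  | succ n ih =>
    rw [follow] at hy
    split_ifs at hy with ht
    · obtain ⟨z, hz, hy⟩ := (PMF.mem_support_bind_iff _ _ _).1 hy
      obtain ⟨m, hm, s', rfl⟩ := alg.mem_support_learnStep hz
      exact ih hy (by simp only [learnNext]; omega)
    · rw [(PMF.mem_support_pure_iff _ _).1 hy]
      omega

theorem fresh_learnNext {x : RunState S A T} (hx : x.Fresh) (π : S → A) (m : ℕ) (s' : S) :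
    (learnNext ℓ π x m s').Fresh := by
  intro i hi
  simp only [learnNext] at hi ⊢
  rw [if_neg (by omega), hx i (by omega)]

/-- Freshness makes overwriting the current entry the same as adding to zero, so each step changes
every linear functional by a single term. -/
theorem pairing_learnNext {x : RunState S A T} (hx : x.Fresh) (ht : x.t < T)
    (w : ℕ → S → A → ℝ) (π : S → A) (m : ℕ) (s' : S) :
    pairing w (learnNext ℓ π x m s').est =
      pairing w x.est + w x.t x.s (π x.s) * ℓ x.t x.s (π x.s) * m := by
  have h : ∀ i : Fin T × S × A, w i.1 i.2.1 i.2.2 * (learnNext ℓ π x m s').est i =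
      w i.1 i.2.1 i.2.2 * x.est i + if i = (⟨x.t, ht⟩, x.s, π x.s) then
        w x.t x.s (π x.s) * ℓ x.t x.s (π x.s) * m else 0 := by
    rintro ⟨i, s, a⟩
    simp only [learnNext, Prod.mk.injEq, Fin.ext_iff]
    split_ifs with h
    · obtain ⟨h1, h2, h3⟩ := h
      subst h2 h3
      rw [hx _ h1.ge, h1]
      ring
    · simp
  rw [pairing, Finset.sum_congr rfl fun i _ => h i, Finset.sum_add_distrib, Finset.sum_ite_eq']
  simp [pairing]

/-- The number of trials is independent of the next state, so only its mean enters. Two cases are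
used: α = 1 with w = −q for the learner's side, and α = 0 with nonnegative w for the comparator. -/
theorem expect_follow_linear (alg : FTPL M T) (c : Fin T × S × A → ℝ) (π : S → A) {tEnd : ℕ}
    (hEnd : tEnd ≤ T) (α : ℝ) (w : ℕ → S → A → ℝ) (n : ℕ) {x : RunState S A T} (hx : x.Fresh) :
    ((alg.follow ℓ c π tEnd n x).expect fun y => α * y.loss + pairing w y.est) =
      α * x.loss + pairing w x.est + M.pathSum π tEnd
        (fun t s a => α * ℓ t s a + w t s a * ℓ t s a * alg.trials c alg.L t s a) n x.t x.s := by
  induction n generalizing x with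
  | zero => simp [follow, MDP.pathSum]
  | succ n ih =>
    rw [follow, MDP.pathSum]
    split_ifs with ht
    swap
    · simp
    rw [PMF.expect_bind, expect_learnStep]
    have h : ∀ m s', ((alg.follow ℓ c π tEnd n (learnNext ℓ π x m s')).expect fun y =>
        α * y.loss + pairing w y.est) = (α * x.loss + pairing w x.est + α * ℓ x.t x.s (π x.s) +
        w x.t x.s (π x.s) * ℓ x.t x.s (π x.s) * m) + M.pathSum π tEnd
        (fun t s a => α * ℓ t s a + w t s a * ℓ t s a * alg.trials c alg.L t s a) n (x.t + 1) s' := by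
      intro m s'
      rw [ih (fresh_learnNext hx π m s'), pairing_learnNext hx (ht.trans_le hEnd)]
      simp only [learnNext]
      ring
    simp only [h]
    simp only [PMF.expect_add, PMF.expect_const, PMF.expect_const_mul]
    rw [← trials]
    ring

/-- This estimates E[‖d‖₁⟨q, d⟩] for the increment d of the estimators. A step with M trials adds ℓM
to the first factor and qℓM to the second. In products of different steps, q·E[M] ≤ 1 removes one
factor M; on the diagonal q·E[M²] ≤ 2E[M] does so. The offsets `u`, `v` make the induction apply
after some increment has already accumulated. -/
theorem expect_follow_mul_le (alg : FTPL M T) (hℓ : ∀ t s a, ℓ t s a ∈ Set.Icc (0 : ℝ) 1)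
    (c : Fin T × S × A → ℝ) (π : S → A) {tEnd : ℕ} (hEnd : tEnd ≤ T) (n : ℕ) {x : RunState S A T}
    (hx : x.Fresh) {u v : ℝ} (hu : u ≤ pairing 1 x.est)
    (hv : v ≤ pairing (alg.leaderOcc c) x.est) :
    ((alg.follow ℓ c π tEnd n x).expect fun y =>
        (pairing 1 y.est - u) * (pairing (alg.leaderOcc c) y.est - v)) ≤
      (pairing 1 x.est - u) * (pairing (alg.leaderOcc c) x.est - v) +
        (pairing 1 x.est - u) * n + (pairing (alg.leaderOcc c) x.est - v + n + 1) *
        M.pathSum π tEnd (alg.trials c alg.L) n x.t x.s := by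
  induction n generalizing x with
  | zero => simp [follow, MDP.pathSum]
  | succ n ih =>
    rw [follow, MDP.pathSum]
    split_ifs with ht
    swap
    · simp only [PMF.expect_pure]
      push_cast
      nlinarith
    rw [PMF.expect_bind, expect_learnStep]
    have hl := hℓ x.t x.s (π x.s)
    have hq0 := alg.leaderOcc_nonneg c x.t x.s (π x.s)
    have hqr := alg.leaderOcc_mul_trials_le c alg.L x.t x.s (π x.s)
    have hqe := alg.leaderOcc_mul_expect_sq_le c alg.L x.t x.s (π x.s)
    have hr := alg.trials_nonneg c alg.L x.t x.s (π x.s)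
    have hR : 0 ≤ (M.P x.s (π x.s)).expect
        (M.pathSum π tEnd (alg.trials c alg.L) n (x.t + 1)) :=
      PMF.expect_nonneg fun s' _ => M.pathSum_nonneg π tEnd (alg.trials_nonneg c alg.L) n _ s'
    set N₁ := pairing 1 x.est - u with hN₁
    set N₂ := pairing (alg.leaderOcc c) x.est - v with hN₂
    set l := ℓ x.t x.s (π x.s)
    set q := alg.leaderOcc c x.t x.s (π x.s)
    set R := (M.P x.s (π x.s)).expect (M.pathSum π tEnd (alg.trials c alg.L) n (x.t + 1)) with hRdef
    have hN₁0 : 0 ≤ N₁ := by linarith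
    have hN₂0 : 0 ≤ N₂ := by linarith
    have hstep : ∀ m : ℕ, ((M.P x.s (π x.s)).expect fun s' =>
        (alg.follow ℓ c π tEnd n (learnNext ℓ π x m s')).expect fun y =>
          (pairing 1 y.est - u) * (pairing (alg.leaderOcc c) y.est - v)) ≤
        (N₁ * N₂ + N₁ * n + (N₂ + n + 1) * R) + (l * N₂ + q * l * N₁ + l * n + q * l * R) * m +
          q * l ^ 2 * (m : ℝ) ^ 2 := by
      intro m
      have hm : (0 : ℝ) ≤ m := Nat.cast_nonneg m
      calc _ ≤ (M.P x.s (π x.s)).expect fun s' => ((N₁ + l * m) * (N₂ + q * l * m) +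
            (N₁ + l * m) * n) + (N₂ + q * l * m + n + 1) *
            M.pathSum π tEnd (alg.trials c alg.L) n (x.t + 1) s' := by
            refine PMF.expect_mono fun s' _ => ?_
            have e1 := pairing_learnNext (ℓ := ℓ) hx (ht.trans_le hEnd) 1 π m s'
            have e2 := pairing_learnNext (ℓ := ℓ) hx (ht.trans_le hEnd)
              (alg.leaderOcc c) π m s'
            simp only [Pi.one_apply, one_mul] at e1
            have h1 : 0 ≤ l * m := mul_nonneg hl.1 hm
            have h2 : 0 ≤ q * l * m := mul_nonneg (mul_nonneg hq0 hl.1) hm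
            refine (ih (fresh_learnNext hx π m s') (by rw [e1]; linarith)
              (by rw [e2]; linarith)).trans_eq ?_
            rw [e1, e2, hN₁, hN₂]
            simp only [learnNext]
            ring
        _ = _ := by
            rw [PMF.expect_add, PMF.expect_const, PMF.expect_const_mul, ← hRdef]
            ring
    refine (PMF.expect_mono fun m _ => hstep m).trans ?_
    rw [PMF.expect_add, PMF.expect_add, PMF.expect_const, PMF.expect_const_mul,
      PMF.expect_const_mul, ← trials]
    set r := alg.trials c alg.L x.t x.s (π x.s)
    set e := (alg.resample c x.t x.s (π x.s) alg.L).expect fun m => (m : ℝ) ^ 2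
    have he : 0 ≤ e := PMF.expect_nonneg fun _ _ => sq_nonneg _
    -- The five terms of the expanded step. Their bounds add up exactly to the increase of the
    -- right-hand side from `n` to `n + 1`.
    have b1 : l * N₂ * r ≤ N₂ * r :=
      mul_le_mul_of_nonneg_right (mul_le_of_le_one_left hN₂0 hl.2) hr
    have b2 : q * l * N₁ * r ≤ N₁ := by
      have : l * (q * r) ≤ 1 := mul_le_one₀ hl.2 (mul_nonneg hq0 hr) hqr
      nlinarith
    have b3 : l * n * r ≤ n * r :=
      mul_le_mul_of_nonneg_right (mul_le_of_le_one_left (Nat.cast_nonneg _) hl.2) hr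
    have b4 : q * l * R * r ≤ R := by
      have : l * (q * r) ≤ 1 := mul_le_one₀ hl.2 (mul_nonneg hq0 hr) hqr
      nlinarith
    have b5 : q * l ^ 2 * e ≤ 2 * r := by
      have h1 : l ^ 2 ≤ 1 := pow_le_one₀ hl.1 hl.2
      have h2 : 0 ≤ q * e := mul_nonneg hq0 he
      nlinarith
    push_cast
    nlinarith

end FTPL

/-! ### Laplace noise: shifts and exponential moments -/

open MeasureTheory

/-- Comparison on boxes suffices, since `OuterMeasure.pi` is the largest outer measure bounded on
boxes by the product of the side measures (`OuterMeasure.le_pi`). -/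
theorem MeasureTheory.Measure.pi_le_prod_smul {ι : Type*} [Fintype ι] {α : ι → Type*}
    [∀ i, MeasurableSpace (α i)] (μ ν : ∀ i, Measure (α i)) [∀ i, IsFiniteMeasure (μ i)]
    [∀ i, IsFiniteMeasure (ν i)] {c : ι → ℝ≥0∞} (hc : ∀ i, c i ≠ ⊤) (h : ∀ i, μ i ≤ c i • ν i) :
    Measure.pi μ ≤ (∏ i, c i) • Measure.pi ν := by
  have hfin : ∀ i, IsFiniteMeasure (c i • ν i) := fun i => (ν i).smul_finite (hc i)
  have h1 : Measure.pi (fun i => c i • ν i) = (∏ i, c i) • Measure.pi ν := by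
    refine Measure.pi_eq fun s _ => ?_
    simp [Measure.smul_apply, Measure.pi_pi, Finset.prod_mul_distrib]
  have h2 : (Measure.pi μ).toOuterMeasure ≤
      OuterMeasure.pi fun i => (c i • ν i).toOuterMeasure := by
    rw [OuterMeasure.le_pi]
    intro s _
    rw [Measure.coe_toOuterMeasure, Measure.pi_pi]
    exact Finset.prod_le_prod' fun i _ => h i (s i)
  rw [← h1, Measure.le_iff]
  intro s hs
  have h3 : Measure.pi (fun i => c i • ν i) s =
      OuterMeasure.pi (fun i => (c i • ν i).toOuterMeasure) s := by
    rw [Measure.pi, toMeasure_apply _ _ hs]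
  rw [h3]
  exact h2 s

section Laplace

variable {η : ℝ}

/-- By the triangle inequality the Laplace density and its shift by `a` have a ratio of at most
exp(η|a|). -/
theorem laplace_le_smul_map (hη : 0 < η) (a : ℝ) :
    laplace η ≤ ENNReal.ofReal (Real.exp (η * |a|)) • (laplace η).map (a + ·) := by
  rw [Measure.le_iff]
  intro s hs
  have hm : Measurable fun x : ℝ => ENNReal.ofReal (η / 2 * Real.exp (-(η * |x|))) := by fun_prop
  rw [Measure.smul_apply, Measure.map_apply (by fun_prop) hs, laplace,
    withDensity_apply _ hs, withDensity_apply _ (measurable_const_add a hs),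
    ← lintegral_indicator hs, ← lintegral_indicator (measurable_const_add a hs),
    smul_eq_mul, ← lintegral_const_mul _ (hm.indicator (measurable_const_add a hs)),
    ← lintegral_add_left_eq_self _ a]
  refine lintegral_mono fun x => ?_
  by_cases hx : a + x ∈ s
  · rw [Set.indicator_of_mem hx, Set.indicator_of_mem (by exact hx),
      ← ENNReal.ofReal_mul (Real.exp_pos _).le]
    refine ENNReal.ofReal_le_ofReal ?_
    have h1 : |x| ≤ |a + x| + |a| := by
      have := abs_sub_abs_le_abs_sub x (-a)
      rw [abs_neg, sub_neg_eq_add, add_comm x a] at this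
      linarith
    have h2 : Real.exp (-(η * |a + x|)) ≤ Real.exp (η * |a|) * Real.exp (-(η * |x|)) := by
      rw [← Real.exp_add]
      refine Real.exp_le_exp.2 ?_
      nlinarith
    nlinarith
  · rw [Set.indicator_of_notMem hx]
    exact zero_le

theorem integral_laplace (hη : 0 < η) (f : ℝ → ℝ) :
    ∫ x, f x ∂laplace η = ∫ x, η / 2 * Real.exp (-(η * |x|)) * f x := by
  rw [laplace, integral_withDensity_eq_integral_toReal_smul (by fun_prop)
    (Filter.Eventually.of_forall fun x => ENNReal.ofReal_lt_top)]
  refine integral_congr_ae (Filter.Eventually.of_forall fun x => ?_)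
  simp only [smul_eq_mul]
  rw [ENNReal.toReal_ofReal (by positivity)]

theorem integrable_laplace_iff (hη : 0 < η) (f : ℝ → ℝ) :
    Integrable f (laplace η) ↔ Integrable fun x => η / 2 * Real.exp (-(η * |x|)) * f x := by
  rw [laplace, integrable_withDensity_iff_integrable_smul' (by fun_prop)
    (Filter.Eventually.of_forall fun x => ENNReal.ofReal_lt_top)]
  refine integrable_congr (Filter.Eventually.of_forall fun x => ?_)
  simp only [smul_eq_mul]
  rw [ENNReal.toReal_ofReal (by positivity)]

theorem integrableOn_laplace_exp {a : ℝ} (h1 : -η < a) (h2 : a < η) :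
    IntegrableOn (fun x : ℝ => Real.exp (-(η * |x|)) * Real.exp (a * x)) (Set.Iic 0) ∧
    IntegrableOn (fun x : ℝ => Real.exp (-(η * |x|)) * Real.exp (a * x)) (Set.Ioi 0) ∧
    ∫ x in Set.Iic 0, Real.exp (-(η * |x|)) * Real.exp (a * x) = 1 / (η + a) ∧
    ∫ x in Set.Ioi 0, Real.exp (-(η * |x|)) * Real.exp (a * x) = 1 / (η - a) := by
  have e1 : Set.EqOn (fun x : ℝ => Real.exp ((η + a) * x))
      (fun x => Real.exp (-(η * |x|)) * Real.exp (a * x)) (Set.Iic 0) := by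
    intro x hx
    simp only
    rw [← Real.exp_add, abs_of_nonpos (Set.mem_Iic.1 hx)]
    congr 1
    ring
  have e2 : Set.EqOn (fun x : ℝ => Real.exp ((a - η) * x))
      (fun x => Real.exp (-(η * |x|)) * Real.exp (a * x)) (Set.Ioi 0) := by
    intro x hx
    simp only
    rw [← Real.exp_add, abs_of_pos (Set.mem_Ioi.1 hx)]
    congr 1
    ring
  refine ⟨(integrableOn_congr_fun e1 measurableSet_Iic).1
      (integrableOn_exp_mul_Iic (by linarith) 0),
    (integrableOn_congr_fun e2 measurableSet_Ioi).1 (integrableOn_exp_mul_Ioi (by linarith) 0),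
    ?_, ?_⟩
  · rw [← setIntegral_congr_fun measurableSet_Iic e1, integral_exp_mul_Iic (by linarith)]
    simp
  · rw [← setIntegral_congr_fun measurableSet_Ioi e2, integral_exp_mul_Ioi (by linarith)]
    rw [mul_zero, Real.exp_zero, ← neg_div_neg_eq, neg_neg, neg_sub]

theorem integrable_exp_laplace (hη : 0 < η) {a : ℝ} (h1 : -η < a) (h2 : a < η) :
    Integrable (fun x => Real.exp (a * x)) (laplace η) := by
  rw [integrable_laplace_iff hη]
  obtain ⟨i1, i2, -, -⟩ := integrableOn_laplace_exp h1 h2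
  have := i1.union i2
  rw [Set.Iic_union_Ioi, integrableOn_univ] at this
  simpa only [mul_assoc] using this.const_mul (η / 2)

/-- The moment generating function is 1/(1 − x) with x = (a/η)² ≤ 1/4, and (1 − x)(1 + 2x) ≥ 1 in
this range. -/
theorem integral_exp_laplace_le (hη : 0 < η) {a : ℝ} (ha : |a| ≤ η / 2) :
    ∫ x, Real.exp (a * x) ∂laplace η ≤ Real.exp (2 * (a / η) ^ 2) := by
  obtain ⟨h1, h2⟩ := abs_le.1 ha
  obtain ⟨i1, i2, e1, e2⟩ := integrableOn_laplace_exp (η := η) (a := a) (by linarith) (by linarith)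
  rw [integral_laplace hη]
  simp only [mul_assoc]
  rw [integral_const_mul, ← intervalIntegral.integral_Iic_add_Ioi i1 i2, e1, e2]
  have hs : (a / η) ^ 2 ≤ 1 / 4 := by
    have : |a / η| ≤ 1 / 2 := by
      rw [abs_div, abs_of_pos hη, div_le_iff₀ hη]
      linarith
    calc (a / η) ^ 2 = |a / η| ^ 2 := (sq_abs _).symm
      _ ≤ (1 / 2) ^ 2 := by gcongr
      _ = 1 / 4 := by norm_num
  have h3 : η / 2 * (1 / (η + a) + 1 / (η - a)) = 1 / (1 - (a / η) ^ 2) := by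
    have := (show (0 : ℝ) < η + a by linarith).ne'
    have := (show (0 : ℝ) < η - a by linarith).ne'
    have h4 : 1 - (a / η) ^ 2 = (η + a) * (η - a) / η ^ 2 := by
      field_simp
      ring
    rw [h4]
    field_simp
    ring
  rw [h3, div_le_iff₀ (by linarith)]
  have h5 := Real.add_one_le_exp (2 * (a / η) ^ 2)
  have h6 : 0 ≤ (a / η) ^ 2 := sq_nonneg _
  nlinarith

theorem integrable_exp_sum_laplace {ι : Type*} [Fintype ι] (hη : 0 < η) {a : ι → ℝ}
    (ha : ∀ i, |a i| ≤ η / 2) :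
    Integrable (fun z : ι → ℝ => Real.exp (∑ i, a i * z i)) (Measure.pi fun _ => laplace η) ∧
      ∫ z : ι → ℝ, Real.exp (∑ i, a i * z i) ∂(Measure.pi fun _ => laplace η) ≤
        Real.exp (∑ i, 2 * (a i / η) ^ 2) := by
  have := isProbabilityMeasure_laplace hη
  simp only [Real.exp_sum]
  constructor
  · exact Integrable.fintype_prod (f := fun i x => Real.exp (a i * x)) fun i =>
      integrable_exp_laplace hη (by linarith [(abs_le.1 (ha i)).1])
        (by linarith [(abs_le.1 (ha i)).2])
  · rw [integral_fintype_prod_eq_prod (fun i x => Real.exp (a i * x))]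
    exact Finset.prod_le_prod (fun i _ => integral_nonneg fun x => (Real.exp_pos _).le)
      fun i _ => integral_exp_laplace_le hη (ha i)

theorem integrable_id_laplace (hη : 0 < η) : Integrable (fun x => x) (laplace η) := by
  have i1 := integrable_exp_laplace hη (a := η / 2) (by linarith) (by linarith)
  have i2 := integrable_exp_laplace hη (a := -(η / 2)) (by linarith) (by linarith)
  refine ((i1.add i2).const_mul (2 / η)).mono' (by fun_prop)
    (Filter.Eventually.of_forall fun x => ?_)
  simp only [Pi.add_apply, Real.norm_eq_abs]
  have h1 := Real.add_one_le_exp (η / 2 * x)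
  have h2 := Real.add_one_le_exp (-(η / 2) * x)
  have h3 := Real.exp_pos (η / 2 * x)
  have h4 := Real.exp_pos (-(η / 2) * x)
  rw [div_mul_eq_mul_div, le_div_iff₀ hη]
  rcases abs_cases x with ⟨h, -⟩ | ⟨h, -⟩ <;> rw [h] <;> linarith

theorem integral_id_laplace (hη : 0 < η) : ∫ x, x ∂laplace η = 0 := by
  rw [integral_laplace hη]
  have h := integral_neg_eq_self (fun x => η / 2 * Real.exp (-(η * |x|)) * x) volume
  simp only [abs_neg, mul_neg, integral_neg] at h
  linarith

end Laplace

/-! ### Follow the perturbed leader: the potential Φ -/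

namespace MDP

variable {S A : Type*} [Fintype S] [Fintype A] [DecidableEq A] {T : ℕ}

theorem policyCost_add (M : MDP S A) (c d : Fin T × S × A → ℝ) (π : S → A) :
    M.policyCost (c + d) π = M.policyCost c π + M.policyCost d π := by
  simp [policyCost, mul_add, Finset.sum_add_distrib]

theorem policyCost_nonneg (M : MDP S A) {c : Fin T × S × A → ℝ} (hc : ∀ i, 0 ≤ c i) (π : S → A) :
    0 ≤ M.policyCost c π :=
  Finset.sum_nonneg fun i _ => mul_nonneg ENNReal.toReal_nonneg (hc i)

theorem measurable_policyCost (M : MDP S A) (π : S → A) :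
    Measurable fun c : Fin T × S × A → ℝ => M.policyCost c π := by
  unfold policyCost
  fun_prop

theorem sum_occ (M : MDP S A) (π : S → A) :
    ∑ i : Fin T × S × A, (M.occ π i.1 i.2.1 i.2.2).toReal = T := by
  rw [Fintype.sum_prod_type]
  have h : ∀ t : Fin T, ∑ i : S × A, (M.occ π t i.1 i.2).toReal = 1 := by
    intro t
    have := M.expect_stateLaw π t fun _ _ => 1
    rw [Fintype.sum_prod_type]
    simpa using this.symm
  simp [h]

end MDP

namespace FTPL

variable {S A : Type*} [Fintype S] [Fintype A] [DecidableEq S] [DecidableEq A]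
  {M : MDP S A} {T : ℕ}

/-- The law of the perturbation. -/
noncomputable def noise (alg : FTPL M T) : Measure (Fin T × S × A → ℝ) :=
  Measure.pi fun _ => laplace alg.η

instance (alg : FTPL M T) : IsProbabilityMeasure (laplace alg.η) :=
  isProbabilityMeasure_laplace alg.η_pos

instance (alg : FTPL M T) : IsProbabilityMeasure alg.noise := by
  unfold noise
  infer_instance

theorem leader_apply (alg : FTPL M T) (c : Fin T × S × A → ℝ) (π : S → A) :
    alg.leader c π = alg.noise {z | alg.oracle.plan (c + z) = π} := rfl

theorem measurableSet_plan (alg : FTPL M T) (c : Fin T × S × A → ℝ) (π : S → A) :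
    MeasurableSet {z | alg.oracle.plan (c + z) = π} :=
  (measurable_const_add c) (alg.oracle.measurable_plan π)

/-- Stability: replacing the costs `c` by `c + d` amounts to shifting the noise by `d`, which costs
a factor exp(η|d i|) in each coordinate. -/
theorem leader_le (alg : FTPL M T) (c d : Fin T × S × A → ℝ) (π : S → A) :
    alg.leader c π ≤ ENNReal.ofReal (Real.exp (alg.η * ∑ i, |d i|)) * alg.leader (c + d) π := by
  have hfin : ∀ i, IsProbabilityMeasure ((laplace alg.η).map (d i + ·)) := fun i =>
    Measure.isProbabilityMeasure_map (by fun_prop)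
  have h1 := Measure.pi_le_prod_smul (fun _ : Fin T × S × A => laplace alg.η)
    (fun i => (laplace alg.η).map (d i + ·)) (fun i => ENNReal.ofReal_ne_top)
    (fun i => laplace_le_smul_map alg.η_pos (d i))
  have h2 : Measure.pi (fun i => (laplace alg.η).map (d i + ·)) =
      alg.noise.map fun z => d + z :=
    (Measure.pi_map_pi (μ := fun _ : Fin T × S × A => laplace alg.η)
      (f := fun i x => d i + x) fun i => by fun_prop).symm
  have h3 := h1 {z | alg.oracle.plan (c + z) = π}
  rw [h2, Measure.smul_apply, Measure.map_apply (by fun_prop) (alg.measurableSet_plan c π),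
    ← ENNReal.ofReal_prod_of_nonneg (fun i _ => (Real.exp_pos _).le), ← Real.exp_sum,
    ← Finset.mul_sum, smul_eq_mul] at h3
  rw [leader_apply, leader_apply]
  simp only [add_assoc]
  exact h3

theorem integrable_eval (alg : FTPL M T) (i : Fin T × S × A) :
    Integrable (fun z => z i) alg.noise :=
  (measurePreserving_eval (fun _ => laplace alg.η) i).integrable_comp_of_integrable
    (integrable_id_laplace alg.η_pos)

theorem integral_eval (alg : FTPL M T) (i : Fin T × S × A) : ∫ z, z i ∂alg.noise = 0 := by
  rw [← integral_id_laplace alg.η_pos,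
    ← (measurePreserving_eval (fun _ : Fin T × S × A => laplace alg.η) i).map_eq,
    integral_map (measurable_pi_apply i).aemeasurable (by fun_prop)]
  rfl

theorem integrable_policyCost (alg : FTPL M T) (c : Fin T × S × A → ℝ) (π : S → A) :
    Integrable (fun z => M.policyCost (c + z) π) alg.noise := by
  simp only [M.policyCost_add]
  refine (integrable_const _).add (integrable_finsetSum _ fun i _ => ?_)
  exact (alg.integrable_eval i).const_mul _

theorem integral_policyCost (alg : FTPL M T) (c : Fin T × S × A → ℝ) (π : S → A) :
    ∫ z, M.policyCost (c + z) π ∂alg.noise = M.policyCost c π := by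
  simp only [M.policyCost_add]
  have h := fun i : Fin T × S × A =>
    (alg.integrable_eval i).const_mul (M.occ π i.1 i.2.1 i.2.2).toReal
  have hs : Integrable (fun z => M.policyCost z π) alg.noise :=
    integrable_finsetSum _ fun i _ => h i
  rw [integral_add (integrable_const _) hs, integral_const]
  have : ∫ z, M.policyCost z π ∂alg.noise = 0 := by
    simp only [MDP.policyCost]
    rw [integral_finsetSum _ fun i _ => h i]
    simp [integral_const_mul, integral_eval]
  rw [this]
  simp

/-- The expected least cost of a policy for the costs `c` after perturbation. -/
noncomputable def perturbedMin (alg : FTPL M T) (c : Fin T × S × A → ℝ) : ℝ :=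
  ∫ z, M.policyCost (c + z) (alg.oracle.plan (c + z)) ∂alg.noise

theorem integrable_indicator_plan (alg : FTPL M T) (c : Fin T × S × A → ℝ)
    (f : (S → A) → (Fin T × S × A → ℝ) → ℝ) (hf : ∀ π, Integrable (f π) alg.noise) :
    Integrable (fun z => f (alg.oracle.plan (c + z)) z) alg.noise := by
  have h : (fun z => f (alg.oracle.plan (c + z)) z) =
      fun z => ∑ π, Set.indicator {z | alg.oracle.plan (c + z) = π} (f π) z := by
    ext z
    rw [Finset.sum_eq_single (alg.oracle.plan (c + z))]
    · simp
    · intro π _ hπ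
      exact Set.indicator_of_notMem (fun h => hπ h.symm) _
    · simp
  rw [h]
  exact integrable_finsetSum _ fun π _ => (hf π).indicator (alg.measurableSet_plan c π)

theorem integral_plan (alg : FTPL M T) (c : Fin T × S × A → ℝ) (f : (S → A) → ℝ) :
    ∫ z, f (alg.oracle.plan (c + z)) ∂alg.noise = (alg.leader c).expect f := by
  have h : (fun z => f (alg.oracle.plan (c + z))) =
      fun z => ∑ π, Set.indicator {z | alg.oracle.plan (c + z) = π} (fun _ => f π) z := by
    ext z
    rw [Finset.sum_eq_single (alg.oracle.plan (c + z))]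
    · simp
    · intro π _ hπ
      exact Set.indicator_of_notMem (fun h => hπ h.symm) _
    · simp
  rw [h, integral_finsetSum _ fun π _ =>
    (integrable_const _).indicator (alg.measurableSet_plan c π), PMF.expect_fintype]
  refine Finset.sum_congr rfl fun π _ => ?_
  rw [integral_indicator_const _ (alg.measurableSet_plan c π), leader_apply, smul_eq_mul]
  rfl

theorem integrable_perturbedMin (alg : FTPL M T) (c : Fin T × S × A → ℝ) :
    Integrable (fun z => M.policyCost (c + z) (alg.oracle.plan (c + z))) alg.noise :=
  alg.integrable_indicator_plan c (fun π z => M.policyCost (c + z) π)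
    fun π => alg.integrable_policyCost c π

/-- The minimum is at most the perturbed cost of the fixed policy `π`, and the noise has mean zero.
-/
theorem perturbedMin_le (alg : FTPL M T) (c : Fin T × S × A → ℝ) (π : S → A) :
    alg.perturbedMin c ≤ M.policyCost c π := by
  rw [← alg.integral_policyCost c π]
  exact integral_mono (alg.integrable_perturbedMin c) (alg.integrable_policyCost c π)
    fun z => alg.oracle.optimal (c + z) π

/-- The policy that takes the new costs `d` into account pays at most the increase of the
perturbed minimum for them. -/
theorem expect_leader_add_le (alg : FTPL M T) (c d : Fin T × S × A → ℝ) :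
    alg.perturbedMin c + (alg.leader (c + d)).expect (M.policyCost d) ≤
      alg.perturbedMin (c + d) := by
  rw [← alg.integral_plan, perturbedMin, perturbedMin,
    ← integral_add (alg.integrable_perturbedMin c)
      (alg.integrable_indicator_plan (c + d) (fun π _ => M.policyCost d π)
        fun _ => integrable_const _)]
  refine integral_mono ((alg.integrable_perturbedMin c).add
    (alg.integrable_indicator_plan (c + d) (fun π _ => M.policyCost d π)
        fun _ => integrable_const _)) (alg.integrable_perturbedMin (c + d)) fun z => ?_
  simp only
  have h := alg.oracle.optimal (c + z) (alg.oracle.plan (c + d + z))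
  have e : c + d + z = c + z + d := by abel
  rw [e] at h ⊢
  rw [M.policyCost_add (c + z) d]
  linarith

/-- By `expect_leader_add_le` the leader that already knows `d` pays at most the increase of Φ. By
`leader_le` its law is at least exp(−η‖d‖₁) ≥ 1 − η‖d‖₁ times the law of the actual leader. -/
theorem perturbedMin_add_ge (alg : FTPL M T) (c : Fin T × S × A → ℝ) {d : Fin T × S × A → ℝ}
    (hd : ∀ i, 0 ≤ d i) :
    alg.perturbedMin c + (1 - alg.η * ∑ i, d i) * pairing (alg.leaderOcc c) d ≤
      alg.perturbedMin (c + d) := by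
  refine le_trans ?_ (alg.expect_leader_add_le c d)
  rw [pairing_leaderOcc, ← PMF.expect_const_mul, PMF.expect_fintype, PMF.expect_fintype]
  refine add_le_add le_rfl (Finset.sum_le_sum fun π _ => ?_)
  rw [← mul_assoc, mul_comm (alg.leader c π).toReal]
  refine mul_le_mul_of_nonneg_right (a := M.policyCost d π) ?_ (M.policyCost_nonneg hd π)
  have h1 := ENNReal.toReal_mono (ENNReal.mul_ne_top ENNReal.ofReal_ne_top
    (PMF.apply_ne_top _ _)) (alg.leader_le c d π)
  rw [ENNReal.toReal_mul, ENNReal.toReal_ofReal (Real.exp_pos _).le,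
    Finset.sum_congr rfl fun i _ => abs_of_nonneg (hd i)] at h1
  set u := alg.η * ∑ i, d i
  have h2 : 1 - u ≤ Real.exp (-u) := by linarith [Real.add_one_le_exp (-u)]
  calc (1 - u) * (alg.leader c π).toReal ≤ Real.exp (-u) * (alg.leader c π).toReal := by gcongr
    _ ≤ Real.exp (-u) * (Real.exp u * (alg.leader (c + d) π).toReal) := by gcongr
    _ = (alg.leader (c + d) π).toReal := by
      rw [← mul_assoc, ← Real.exp_add, neg_add_cancel, Real.exp_zero, one_mul]

/-- The noise in the cost of a policy has weights in [0, 1] with sum `T`, so the sum of their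
squares is at most `T`, without a factor SA. -/
theorem integrable_exp_policyCost (alg : FTPL M T) {r : ℝ} (hr : 0 ≤ r) (hr2 : r ≤ alg.η / 2)
    (π : S → A) :
    Integrable (fun z => Real.exp (-(r * M.policyCost z π))) alg.noise ∧
      ∫ z, Real.exp (-(r * M.policyCost z π)) ∂alg.noise ≤ Real.exp (2 * (r / alg.η) ^ 2 * T) := by
  have hη := alg.η_pos
  have e : ∀ z : Fin T × S × A → ℝ, -(r * M.policyCost z π) =
      ∑ i, -(r * (M.occ π i.1 i.2.1 i.2.2).toReal) * z i := by
    intro z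
    rw [MDP.policyCost, Finset.mul_sum, ← Finset.sum_neg_distrib]
    exact Finset.sum_congr rfl fun i _ => by ring
  have hb : ∀ i : Fin T × S × A, |-(r * (M.occ π i.1 i.2.1 i.2.2).toReal)| ≤ alg.η / 2 := by
    intro i
    rw [abs_neg, abs_of_nonneg (mul_nonneg hr ENNReal.toReal_nonneg)]
    exact (mul_le_of_le_one_right hr (M.occ_toReal_le_one _ _ _ _)).trans hr2
  simp only [e]
  obtain ⟨h1, h2⟩ := integrable_exp_sum_laplace hη hb
  refine ⟨h1, h2.trans (Real.exp_le_exp.2 ?_)⟩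
  conv_rhs => rw [← M.sum_occ (T := T) π, Finset.mul_sum]
  refine Finset.sum_le_sum fun i _ => ?_
  have h0 : 0 ≤ (M.occ π i.1 i.2.1 i.2.2).toReal := ENNReal.toReal_nonneg
  have h1 := M.occ_toReal_le_one π i.1 i.2.1 i.2.2
  set o := (M.occ π i.1 i.2.1 i.2.2).toReal
  have h2 : o ^ 2 ≤ o := by nlinarith
  calc 2 * (-(r * o) / alg.η) ^ 2 = 2 * (r / alg.η) ^ 2 * o ^ 2 := by ring
    _ ≤ _ := by gcongr

/-- The price of the perturbation. -/
theorem neg_perturbedMin_zero_le (alg : FTPL M T) (hT : 0 < T) [Nonempty A] :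
    -alg.perturbedMin 0 ≤
      (Fintype.card S * Real.log (Fintype.card A) + 1 / 2) * (2 * √T / alg.η) := by
  have hη := alg.η_pos
  have hT1 : (1 : ℝ) ≤ T := by exact_mod_cast hT
  have hsT : 1 ≤ √(T : ℝ) := Real.one_le_sqrt.2 hT1
  have hA : (0 : ℝ) < Fintype.card A := by exact_mod_cast Fintype.card_pos
  -- This choice makes the exponent 2(r/η)²T equal to 1/2 and keeps r ≤ η/2.
  set r := alg.η / (2 * √T) with hr
  have hr0 : 0 < r := by positivity
  have hr2 : r ≤ alg.η / 2 := by
    rw [hr]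
    gcongr
    linarith
  have hexp : 2 * (r / alg.η) ^ 2 * T = 1 / 2 := by
    have : (√(T : ℝ)) ^ 2 = T := Real.sq_sqrt (by linarith)
    rw [hr]
    field_simp
    rw [this]
  -- exp K = A^S·exp(1/2) bounds the sum of the exponential moments over all A^S policies.
  set K := (Fintype.card S * Real.log (Fintype.card A) + 1 / 2 : ℝ)
  have hK : Real.exp K = (Fintype.card A : ℝ) ^ Fintype.card S * Real.exp (1 / 2) := by
    rw [Real.exp_add, Real.exp_nat_mul, Real.exp_log hA]
  have hint := fun π => (alg.integrable_exp_policyCost hr0.le hr2 π).1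
  have hsum : Integrable (fun z => ∑ π : S → A, Real.exp (-(r * M.policyCost z π))) alg.noise :=
    integrable_finsetSum _ fun π _ => hint π
  have hle : ∫ z, ∑ π : S → A, Real.exp (-(r * M.policyCost z π)) ∂alg.noise ≤ Real.exp K := by
    rw [integral_finsetSum _ fun π _ => hint π, hK]
    calc _ ≤ ∑ _π : S → A, Real.exp (1 / 2) := Finset.sum_le_sum fun π _ => by
          rw [← hexp]
          exact (alg.integrable_exp_policyCost hr0.le hr2 π).2
      _ = _ := by simp
  have hmain : r * -alg.perturbedMin 0 ≤
      ∫ z, (∑ π : S → A, Real.exp (-(r * M.policyCost z π))) * Real.exp (-K) + (K - 1)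
        ∂alg.noise := by
    rw [perturbedMin, ← integral_neg, ← integral_const_mul]
    refine integral_mono ((alg.integrable_perturbedMin 0).neg.const_mul r)
      ((hsum.mul_const _).add (integrable_const _)) fun z => ?_
    simp only [zero_add]
    have h1 : Real.exp (-(r * M.policyCost z (alg.oracle.plan z))) ≤
        ∑ π : S → A, Real.exp (-(r * M.policyCost z π)) :=
      Finset.single_le_sum (f := fun π => Real.exp (-(r * M.policyCost z π)))
        (fun π _ => (Real.exp_pos _).le) (Finset.mem_univ _)
    have h2 := mul_le_mul_of_nonneg_right h1 (Real.exp_pos (-K)).le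
    rw [← Real.exp_add] at h2
    -- The tangent inequality u + 1 ≤ exp u at u = −r·cost − K takes the place of Jensen's
    -- inequality for the logarithm.
    have h3 := Real.add_one_le_exp (-(r * M.policyCost z (alg.oracle.plan z)) + -K)
    linarith
  rw [integral_add (hsum.mul_const _) (integrable_const _), integral_mul_const,
    integral_const] at hmain
  have h4 : (∫ z, ∑ π : S → A, Real.exp (-(r * M.policyCost z π)) ∂alg.noise) * Real.exp (-K) ≤
      1 := by
    calc _ ≤ Real.exp K * Real.exp (-K) := by gcongr
      _ = 1 := by rw [← Real.exp_add, add_neg_cancel, Real.exp_zero]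
  simp only [probReal_univ, one_smul] at hmain
  have h5 : r * -alg.perturbedMin 0 ≤ K := by linarith
  calc -alg.perturbedMin 0 = (r * -alg.perturbedMin 0) * (2 * √T / alg.η) := by
        rw [hr]
        field_simp
    _ ≤ _ := by gcongr

end FTPL

/-! ### From one epoch to the regret -/

section Pairing

variable {S A : Type*} [Fintype S] [Fintype A] {T : ℕ}

theorem pairing_sub_right (w : ℕ → S → A → ℝ) (c d : Fin T × S × A → ℝ) :
    pairing w (c - d) = pairing w c - pairing w d := by
  simp [pairing, mul_sub]

theorem pairing_neg_left (w : ℕ → S → A → ℝ) (c : Fin T × S × A → ℝ) :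
    pairing (fun t s a => -w t s a) c = -pairing w c := by
  simp [pairing]

theorem pairing_one_left (c : Fin T × S × A → ℝ) : pairing 1 c = ∑ i, c i := by
  simp [pairing]

theorem pairing_restrict (w ℓ : ℕ → S → A → ℝ) :
    pairing w (fun i : Fin T × S × A => ℓ i.1 i.2.1 i.2.2) =
      ∑ t ∈ Finset.range T, ∑ s, ∑ a, w t s a * ℓ t s a := by
  rw [Finset.sum_range, pairing, Fintype.sum_prod_type]
  exact Finset.sum_congr rfl fun t _ => Fintype.sum_prod_type _

end Pairing

namespace FTPL

variable {S A : Type*} [Fintype S] [Fintype A] [DecidableEq S] [DecidableEq A]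
  {M : MDP S A} {T : ℕ} {ℓ : ℕ → S → A → ℝ} {alg : FTPL M T}

instance (alg : FTPL M T) (ℓ : ℕ → S → A → ℝ) (j : ℕ) (x : RunState S A T) :
    (alg.epoch ℓ j x).FinSupp := by
  unfold epoch
  infer_instance

instance finSupp_runEpochs (alg : FTPL M T) (ℓ : ℕ → S → A → ℝ) (j : ℕ) :
    (alg.runEpochs ℓ j).FinSupp := by
  induction j <;> unfold runEpochs <;> infer_instance

/-- The configuration in which an epoch starts its switching procedure. -/
def callOracle (x : RunState S A T) : RunState S A T :=
  { x with calls := x.calls + 1, draws := x.draws + T * Fintype.card S * Fintype.card A }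

/-- The end of the epoch number `j`. -/
noncomputable def epochEnd (alg : FTPL M T) (j : ℕ) : ℕ := min ((j + 1) * alg.epochLength) T

theorem epoch_eq (alg : FTPL M T) (ℓ : ℕ → S → A → ℝ) (j : ℕ) (x : RunState S A T) :
    alg.epoch ℓ j x = (alg.leader x.est).bind fun π =>
      (alg.switch ℓ π T (callOracle x)).bind
        (alg.follow ℓ x.est π (alg.epochEnd j) alg.epochLength) := rfl

theorem mem_support_epoch {j : ℕ} {x y : RunState S A T}
    (hy : y ∈ (alg.epoch ℓ j x).support) :
    ∃ π, ∃ z ∈ (alg.switch ℓ π T (callOracle x)).support,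
      y ∈ (alg.follow ℓ x.est π (alg.epochEnd j) alg.epochLength z).support := by
  rw [epoch_eq] at hy
  obtain ⟨π, -, hy⟩ := (PMF.mem_support_bind_iff _ _ _).1 hy
  obtain ⟨z, hz, hy⟩ := (PMF.mem_support_bind_iff _ _ _).1 hy
  exact ⟨π, z, hz, hy⟩

/-- What holds for all configurations after `j` epochs. -/
structure Valid (alg : FTPL M T) (j : ℕ) (x : RunState S A T) : Prop where
  t_le : x.t ≤ T
  le_t : min (j * alg.epochLength) T ≤ x.t
  fresh : x.Fresh
  calls_le : x.calls ≤ j + x.t * alg.L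
  draws_le : x.draws ≤ (j + x.t * alg.L) * (T * Fintype.card S * Fintype.card A) +
    x.t * alg.L + 2 * x.t
  loss_le : x.loss ≤ x.t

theorem Valid.epoch (hℓ : ∀ t s a, ℓ t s a ∈ Set.Icc (0 : ℝ) 1) (hl : 1 ≤ alg.travelTime) {j : ℕ}
    {x y : RunState S A T} (hx : alg.Valid j x) (hy : y ∈ (alg.epoch ℓ j x).support) :
    alg.Valid (j + 1) y := by
  obtain ⟨π, z, hz, hy⟩ := mem_support_epoch hy
  have h1 := alg.switch_idle (fun t s a => (hℓ t s a).2) hl hz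
  have h2 := alg.follow_learns hℓ hy
  have hzT := h1.t_le_horizon hx.t_le
  have hzt : x.t ≤ z.t := h1.t_le
  have hzf : z.Fresh := by
    intro i hi
    rw [h1.est_eq]
    exact hx.fresh i (hzt.trans hi)
  have hEnd : alg.epochEnd j ≤ T := min_le_right _ _
  refine ⟨h2.t_le_end.trans (max_le hzT hEnd), ?_, h2.fresh hzf, ?_, ?_, ?_⟩
  -- The epoch starts no earlier than min(jH, T), so the fuel H reaches its end; if the switch
  -- overran the epoch, there is nothing to follow.
  · refine alg.follow_end hy ?_
    have := hx.le_t
    rw [add_mul, one_mul]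
    omega
  · have := hx.calls_le
    have := h1.calls_eq
    have := h2.calls_le
    have := Nat.mul_le_mul_right alg.L hzt
    simp only [callOracle] at *
    linarith
  · have e1 := hx.draws_le
    have e2 := h1.draws_le
    have e3 := h2.draws_le
    have e4 := Nat.mul_le_mul_right (alg.L * (T * Fintype.card S * Fintype.card A + 1)) hzt
    simp only [callOracle] at e2
    set N := T * Fintype.card S * Fintype.card A
    have e5 : ∀ t, t * (alg.L * (N + 1)) = t * alg.L * N + t * alg.L := fun t => by ring
    simp only [e5] at e3 e4
    have := h2.t_le
    rw [add_mul] at e1 ⊢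
    rw [add_mul, one_mul]
    linarith
  · have := hx.loss_le
    have := h1.loss_le
    have := h2.loss_le
    simp only [callOracle] at *
    linarith

theorem valid_runEpochs (hℓ : ∀ t s a, ℓ t s a ∈ Set.Icc (0 : ℝ) 1) (hl : 1 ≤ alg.travelTime)
    (j : ℕ) {x : RunState S A T} (hx : x ∈ (alg.runEpochs ℓ j).support) : alg.Valid j x := by
  induction j generalizing x with
  | zero =>
    rw [runEpochs, PMF.mem_support_pure_iff] at hx
    subst hx
    exact ⟨by simp, by simp, fun i _ => rfl, by simp, by simp, by simp⟩
  | succ j ih =>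
    rw [runEpochs] at hx
    obtain ⟨z, hz, hx⟩ := (PMF.mem_support_bind_iff _ _ _).1 hx
    exact (ih hz).epoch hℓ hl hx

theorem pathSum_of_le (M : MDP S A) (π : S → A) {tEnd : ℕ} (κ : ℕ → S → A → ℝ) (n : ℕ) {t : ℕ}
    (ht : tEnd ≤ t) (s : S) : M.pathSum π tEnd κ n t s = 0 := by
  cases n
  · rfl
  · rw [MDP.pathSum, if_neg (not_lt.2 ht)]

/-- `expect_switch_eq_zero`, applied to the centred path sum, replaces the state after the switch by
a draw from the law of `π` at the stopping time. The delay of the start only removes nonnegative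
terms. -/
theorem Tuned.expect_switch_pathSum_le (h : alg.Tuned) (hS : 2 ≤ Fintype.card S)
    (hD : M.diam ≠ ⊤) (hℓ : ∀ t s a, ℓ t s a ≤ 1) (π : S → A) {tEnd : ℕ} (hEnd : tEnd ≤ T)
    {κ : ℕ → S → A → ℝ} (hκ : ∀ t s a, 0 ≤ κ t s a) (n : ℕ) {x : RunState S A T} (hx : x.t ≤ T) :
    ((alg.switch ℓ π T x).expect fun z => M.pathSum π tEnd κ n z.t z.s) ≤
      ∑ t ∈ Finset.Ico x.t tEnd, (M.stateLaw π t).expect fun s => κ t s (π s) := by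
  set g : ℕ → ℝ := fun t => (M.stateLaw π t).expect (M.pathSum π tEnd κ n t) with hg
  have h0 := h.expect_switch_eq_zero hS hD hℓ π
    (fun t s => if t < T then M.pathSum π tEnd κ n t s - g t else 0)
    (fun t ht => by simp only [ht, if_true]; rw [PMF.expect_sub, PMF.expect_const, hg, sub_self])
    (fun t s ht => if_neg (not_lt.2 ht)) T x hx (by omega)
  calc _ = ((alg.switch ℓ π T x).expect fun z =>
        if z.t < T then M.pathSum π tEnd κ n z.t z.s - g z.t else 0) +
        (alg.switch ℓ π T x).expect fun z => if z.t < T then g z.t else 0 := by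
        rw [← PMF.expect_add]
        refine PMF.expect_congr fun z _ => ?_
        split_ifs with hz
        · ring
        · rw [pathSum_of_le M π κ n (hEnd.trans (not_lt.1 hz)), add_zero]
    _ ≤ _ := by
        rw [h0, zero_add]
        refine PMF.expect_le_of_le fun z hz => ?_
        have hnn : ∀ t, 0 ≤ (M.stateLaw π t).expect fun s => κ t s (π s) := fun t =>
          PMF.expect_nonneg fun s _ => hκ _ _ _
        split_ifs
        · refine (M.expect_pathSum_le π tEnd hκ n z.t).trans ?_
          refine Finset.sum_le_sum_of_subset_of_nonneg (Finset.Ico_subset_Ico_left ?_)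
            fun t _ _ => hnn t
          exact (alg.switch_idle hℓ (h.one_le_travelTime hS hD) hz).t_le
        · exact Finset.sum_nonneg fun t _ => hnn t

theorem Tuned.expect_leader_switch_pathSum_le (h : alg.Tuned) (hS : 2 ≤ Fintype.card S)
    (hD : M.diam ≠ ⊤) (hℓ : ∀ t s a, ℓ t s a ≤ 1) (c : Fin T × S × A → ℝ) {tEnd : ℕ}
    (hEnd : tEnd ≤ T) {κ : ℕ → S → A → ℝ} (hκ : ∀ t s a, 0 ≤ κ t s a) (n : ℕ)
    {x : RunState S A T} (hx : x.t ≤ T) :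
    ((alg.leader c).expect fun π => (alg.switch ℓ π T x).expect fun z =>
      M.pathSum π tEnd κ n z.t z.s) ≤
      ∑ t ∈ Finset.Ico x.t tEnd, ∑ s, ∑ a, alg.leaderOcc c t s a * κ t s a := by
  refine (PMF.expect_mono fun π _ =>
    h.expect_switch_pathSum_le hS hD hℓ π hEnd hκ n hx).trans_eq ?_
  rw [PMF.expect_finset_sum]
  exact Finset.sum_congr rfl fun t _ => alg.expect_leader_stateLaw c t (κ t)

/-- The estimators are optimistic in mean: a pair contributes at most wℓ·q·E[M] ≤ wℓ, and slots
spent on switching contribute nothing. -/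
theorem Tuned.expect_epoch_linear_le (h : alg.Tuned) (hS : 2 ≤ Fintype.card S)
    (hD : M.diam ≠ ⊤) (hℓ : ∀ t s a, ℓ t s a ∈ Set.Icc (0 : ℝ) 1) (j : ℕ) {x : RunState S A T}
    (hx : alg.Valid j x) (w : ℕ → S → A → ℝ) (hw : ∀ t s a, 0 ≤ w t s a) :
    ((alg.epoch ℓ j x).expect fun y => pairing w y.est) ≤ pairing w x.est +
      ∑ t ∈ Finset.Ico x.t (alg.epochEnd j), ∑ s, ∑ a, w t s a * ℓ t s a := by
  have hℓ1 := fun t s a => (hℓ t s a).2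
  have hEnd : alg.epochEnd j ≤ T := min_le_right _ _
  set κ : ℕ → S → A → ℝ := fun t s a => w t s a * ℓ t s a * alg.trials x.est alg.L t s a with hκ
  have hκ0 : ∀ t s a, 0 ≤ κ t s a := fun t s a =>
    mul_nonneg (mul_nonneg (hw t s a) (hℓ t s a).1) (alg.trials_nonneg _ _ _ _ _)
  have hstep : ∀ π, (((alg.switch ℓ π T (callOracle x)).bind
      (alg.follow ℓ x.est π (alg.epochEnd j) alg.epochLength)).expect
        fun y => pairing w y.est) = pairing w x.est +
      (alg.switch ℓ π T (callOracle x)).expect fun z =>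
        M.pathSum π (alg.epochEnd j) κ alg.epochLength z.t z.s := by
    intro π
    rw [PMF.expect_bind]
    conv_rhs => rw [← PMF.expect_const (alg.switch ℓ π T (callOracle x)) (pairing w x.est),
      ← PMF.expect_add]
    refine PMF.expect_congr fun z hz => ?_
    have h1 := alg.switch_idle hℓ1 (h.one_le_travelTime hS hD) hz
    have hzf : z.Fresh := fun i hi => by
      rw [h1.est_eq]
      exact hx.fresh i (h1.t_le.trans hi)
    have h2 := alg.expect_follow_linear (ℓ := ℓ) x.est π hEnd 0 w alg.epochLength hzf
    simp only [zero_mul, zero_add] at h2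
    rw [h2, h1.est_eq]
    rfl
  rw [epoch_eq, PMF.expect_bind]
  simp only [hstep]
  rw [PMF.expect_add, PMF.expect_const]
  have h3 := h.expect_leader_switch_pathSum_le hS hD hℓ1 x.est hEnd hκ0 alg.epochLength
    (x := callOracle x) hx.t_le
  have h4 : ∑ t ∈ Finset.Ico x.t (alg.epochEnd j), ∑ s, ∑ a, alg.leaderOcc x.est t s a * κ t s a ≤
      ∑ t ∈ Finset.Ico x.t (alg.epochEnd j), ∑ s, ∑ a, w t s a * ℓ t s a := by
    refine Finset.sum_le_sum fun t _ => Finset.sum_le_sum fun s _ => Finset.sum_le_sum fun a _ => ?_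
    have h5 := alg.leaderOcc_mul_trials_le x.est alg.L t s a
    have h6 : 0 ≤ w t s a * ℓ t s a := mul_nonneg (hw t s a) (hℓ t s a).1
    simp only [hκ]
    nlinarith
  have h3' : _ ≤ ∑ t ∈ Finset.Ico x.t (alg.epochEnd j), ∑ s, ∑ a,
    alg.leaderOcc x.est t s a * κ t s a := h3
  linarith

/-- The bound for the regret of an epoch. -/
noncomputable def epochRegret (alg : FTPL M T) : ℝ :=
  3 * M.diam.toReal / alg.stopProb.toReal + alg.epochLength *
    (Fintype.card S * Fintype.card A / (alg.L + 1) +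
      alg.η * (alg.epochLength + 1) * (Fintype.card S * Fintype.card A))

/-- `perturbedMin_add_ge` with d the increment of the estimators splits the change of the potential
into loss − ⟨q, d⟩, which is linear, and η‖d‖₁⟨q, d⟩, which is quadratic. -/
theorem expect_follow_potential_le (hℓ : ∀ t s a, ℓ t s a ∈ Set.Icc (0 : ℝ) 1) (π : S → A)
    {tEnd : ℕ} (hEnd : tEnd ≤ T) (n : ℕ) {z : RunState S A T} (hz : z.Fresh) :
    ((alg.follow ℓ z.est π tEnd n z).expect fun y => y.loss - alg.perturbedMin y.est) ≤
      z.loss - alg.perturbedMin z.est +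
        (M.pathSum π tEnd (fun t s a => ℓ t s a * (1 - alg.leaderOcc z.est t s a) ^ alg.L) n z.t z.s
          + alg.η * (n + 1) * M.pathSum π tEnd (alg.trials z.est alg.L) n z.t z.s) := by
  have h1 := alg.expect_follow_linear (ℓ := ℓ) z.est π hEnd 1
    (fun t s a => -alg.leaderOcc z.est t s a) n hz
  have h2 := alg.expect_follow_mul_le hℓ z.est π hEnd n hz le_rfl le_rfl
  simp only [sub_self, zero_mul, mul_zero, zero_add, one_mul, pairing_neg_left] at h1 h2
  -- 1 − q·E[M] = (1 − q)^L: the linear part leaves only the truncation bias.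
  have hκ : (fun t s a => ℓ t s a + -alg.leaderOcc z.est t s a * ℓ t s a *
      alg.trials z.est alg.L t s a) =
      fun t s a => ℓ t s a * (1 - alg.leaderOcc z.est t s a) ^ alg.L := by
    ext t s a
    have := alg.leaderOcc_mul_trials z.est alg.L t s a
    linear_combination -ℓ t s a * this
  rw [hκ] at h1
  have hpt : ∀ y ∈ (alg.follow ℓ z.est π tEnd n z).support,
      y.loss - alg.perturbedMin y.est ≤
        (y.loss + -pairing (alg.leaderOcc z.est) y.est) +
          alg.η * ((pairing 1 y.est - pairing 1 z.est) * (pairing (alg.leaderOcc z.est) y.est -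
            pairing (alg.leaderOcc z.est) z.est)) +
        (pairing (alg.leaderOcc z.est) z.est - alg.perturbedMin z.est) := by
    intro y hy
    have h3 := alg.perturbedMin_add_ge z.est (d := y.est - z.est)
      fun i => sub_nonneg.2 ((alg.follow_learns hℓ hy).est_le hz i)
    rw [add_sub_cancel, pairing_sub_right, ← pairing_one_left, pairing_sub_right] at h3
    linarith
  refine (PMF.expect_mono hpt).trans ?_
  rw [PMF.expect_add, PMF.expect_add, PMF.expect_const, PMF.expect_const_mul, h1]
  have := mul_le_mul_of_nonneg_left h2 alg.η_pos.le
  linarith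

/-- Three contributions: switching, at one unit of loss per step; the truncation bias; and the
quadratic stability term. The last two are path sums, which become sums weighted by `leaderOcc` over
at most H slots. -/
theorem Tuned.expect_epoch_potential_le (h : alg.Tuned) (hS : 2 ≤ Fintype.card S)
    (hD : M.diam ≠ ⊤) (hℓ : ∀ t s a, ℓ t s a ∈ Set.Icc (0 : ℝ) 1) (j : ℕ) {x : RunState S A T}
    (hx : alg.Valid j x) :
    ((alg.epoch ℓ j x).expect fun y => y.loss - alg.perturbedMin y.est) ≤
      x.loss - alg.perturbedMin x.est + alg.epochRegret := by
  have hℓ1 := fun t s a => (hℓ t s a).2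
  have hEnd : alg.epochEnd j ≤ T := min_le_right _ _
  set κ : ℕ → S → A → ℝ := fun t s a => ℓ t s a * (1 - alg.leaderOcc x.est t s a) ^ alg.L with hκ
  have hκ0 : ∀ t s a, 0 ≤ κ t s a := fun t s a =>
    mul_nonneg (hℓ t s a).1 (pow_nonneg (by linarith [alg.leaderOcc_le_one x.est t s a]) _)
  set n := alg.epochLength with hn
  set K := 3 * M.diam.toReal / alg.stopProb.toReal with hK
  have hstep : ∀ π, (((alg.switch ℓ π T (callOracle x)).bind
      (alg.follow ℓ x.est π (alg.epochEnd j) n)).expect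
        fun y => y.loss - alg.perturbedMin y.est) ≤ (x.loss - alg.perturbedMin x.est + K) +
      (((alg.switch ℓ π T (callOracle x)).expect fun z =>
        M.pathSum π (alg.epochEnd j) κ n z.t z.s) +
      alg.η * (n + 1) * (alg.switch ℓ π T (callOracle x)).expect fun z =>
        M.pathSum π (alg.epochEnd j) (alg.trials x.est alg.L) n z.t z.s) := by
    intro π
    rw [PMF.expect_bind]
    have hsw := h.expect_switch_t_le hS hD hℓ1 π T (callOracle x) hx.t_le
    calc _ ≤ (alg.switch ℓ π T (callOracle x)).expect fun z =>
          ((x.loss - x.t - alg.perturbedMin x.est) + (z.t : ℝ)) +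
          (M.pathSum π (alg.epochEnd j) κ n z.t z.s + alg.η * (n + 1) *
            M.pathSum π (alg.epochEnd j) (alg.trials x.est alg.L) n z.t z.s) := by
          refine PMF.expect_mono fun z hz => ?_
          have h1 := alg.switch_idle hℓ1 (h.one_le_travelTime hS hD) hz
          have he : z.est = x.est := h1.est_eq
          have hzf : z.Fresh := fun i hi => by
            rw [he]
            exact hx.fresh i (h1.t_le.trans hi)
          have h2 := expect_follow_potential_le (alg := alg) hℓ π hEnd n hzf
          rw [he] at h2
          have h3 := h1.loss_le
          simp only [callOracle] at h3
          refine h2.trans ?_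
          simp only [hκ]
          linarith
      _ ≤ _ := by
          rw [PMF.expect_add, PMF.expect_add, PMF.expect_add, PMF.expect_const,
            PMF.expect_const_mul]
          simp only [callOracle] at hsw ⊢
          linarith
  rw [epoch_eq, PMF.expect_bind]
  refine (PMF.expect_mono fun π _ => hstep π).trans ?_
  rw [PMF.expect_add, PMF.expect_const, PMF.expect_add, PMF.expect_const_mul]
  have h1 := h.expect_leader_switch_pathSum_le hS hD hℓ1 x.est hEnd hκ0 n
    (x := callOracle x) hx.t_le
  have h2 := h.expect_leader_switch_pathSum_le hS hD hℓ1 x.est hEnd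
    (alg.trials_nonneg x.est alg.L) n (x := callOracle x) hx.t_le
  have hcard : ((Finset.Ico (callOracle x).t (alg.epochEnd j)).card : ℝ) ≤ n := by
    rw [Nat.card_Ico]
    have hle : min (j * n) T ≤ x.t := hx.le_t
    have e : alg.epochEnd j = min (j * n + n) T := by rw [epochEnd, add_mul, one_mul]
    have : (callOracle x).t = x.t := rfl
    exact_mod_cast (by omega : alg.epochEnd j - (callOracle x).t ≤ n)
  have hsum : ∀ (f : ℕ → S → A → ℝ) (b : ℝ), 0 ≤ b → (∀ t s a, f t s a ≤ b) →
      ∑ t ∈ Finset.Ico (callOracle x).t (alg.epochEnd j), ∑ s, ∑ a, f t s a ≤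
        n * (Fintype.card S * Fintype.card A * b) := by
    intro f b hb hf
    calc _ ≤ ∑ t ∈ Finset.Ico (callOracle x).t (alg.epochEnd j), ∑ _s : S, ∑ _a : A, b :=
          Finset.sum_le_sum fun t _ => Finset.sum_le_sum fun s _ => Finset.sum_le_sum fun a _ =>
            hf t s a
      _ = (Finset.Ico (callOracle x).t (alg.epochEnd j)).card *
          (Fintype.card S * Fintype.card A * b) := by
          simp [Finset.sum_const, mul_assoc]
      _ ≤ _ := by gcongr
  -- The weight q turns the bias (1 − q)^L into at most 1/(L + 1), also for pairs that are rarely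
  -- visited.
  have h3 := hsum (fun t s a => alg.leaderOcc x.est t s a * κ t s a) (1 / (alg.L + 1))
    (by positivity) fun t s a => by
      have e1 := alg.leaderOcc_nonneg x.est t s a
      have e2 := alg.leaderOcc_le_one x.est t s a
      refine le_trans ?_ (mul_one_sub_pow_le e1 e2 alg.L)
      refine mul_le_mul_of_nonneg_left ?_ e1
      exact mul_le_of_le_one_left (pow_nonneg (by linarith) _) (hℓ1 t s a)
  -- The expected number of trials may be large, but its product with q is at most 1.
  have h4 := hsum (fun t s a => alg.leaderOcc x.est t s a * alg.trials x.est alg.L t s a) 1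
    zero_le_one fun t s a => alg.leaderOcc_mul_trials_le x.est alg.L t s a
  have h5 := mul_le_mul_of_nonneg_left (h2.trans h4)
    (mul_nonneg alg.η_pos.le (by positivity : (0 : ℝ) ≤ n + 1))
  rw [epochRegret, ← hn, ← hK]
  calc _ ≤ (x.loss - alg.perturbedMin x.est + K) +
        (n * (Fintype.card S * Fintype.card A * (1 / (alg.L + 1))) +
          alg.η * (n + 1) * (n * (Fintype.card S * Fintype.card A * 1))) := by
        linarith [h1.trans h3]
    _ = _ := by ring

/-- Epoch ends are random because a switch may overrun, so the true costs are summed up to the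
actual time `x.t`; the difference does not increase in mean from epoch to epoch. -/
theorem Tuned.expect_runEpochs_linear_le (h : alg.Tuned) (hS : 2 ≤ Fintype.card S)
    (hD : M.diam ≠ ⊤) (hℓ : ∀ t s a, ℓ t s a ∈ Set.Icc (0 : ℝ) 1) (w : ℕ → S → A → ℝ)
    (hw : ∀ t s a, 0 ≤ w t s a) (j : ℕ) :
    ((alg.runEpochs ℓ j).expect fun x => pairing w x.est -
      ∑ t ∈ Finset.range x.t, ∑ s, ∑ a, w t s a * ℓ t s a) ≤ 0 := by
  have hl := h.one_le_travelTime hS hD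
  have hnn : ∀ t, 0 ≤ ∑ s, ∑ a, w t s a * ℓ t s a := fun t =>
    Finset.sum_nonneg fun s _ => Finset.sum_nonneg fun a _ => mul_nonneg (hw t s a) (hℓ t s a).1
  induction j with
  | zero => simp [runEpochs, pairing]
  | succ j ih =>
    rw [runEpochs, PMF.expect_bind]
    refine (PMF.expect_mono fun x hx => ?_).trans ih
    have hv := valid_runEpochs hℓ hl j hx
    have h1 := h.expect_epoch_linear_le hS hD hℓ j hv w hw
    calc _ ≤ (alg.epoch ℓ j x).expect fun y => pairing w y.est -
          (∑ t ∈ Finset.range x.t, ∑ s, ∑ a, w t s a * ℓ t s a +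
            ∑ t ∈ Finset.Ico x.t (alg.epochEnd j), ∑ s, ∑ a, w t s a * ℓ t s a) := by
          refine PMF.expect_mono fun y hy => ?_
          have hy1 : alg.epochEnd j ≤ y.t := (hv.epoch hℓ hl hy).le_t
          obtain ⟨π, z, hz, hy⟩ := mem_support_epoch hy
          have hy2 : x.t ≤ y.t := le_trans
            (alg.switch_idle (fun t s a => (hℓ t s a).2) hl hz).t_le (alg.follow_learns hℓ hy).t_le
          have hsub := Finset.sum_le_sum_of_subset_of_nonneg
            (Finset.Ico_subset_Ico_right (a := x.t) hy1) fun t _ _ => hnn t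
          have hadd := Finset.sum_range_add_sum_Ico (fun t => ∑ s, ∑ a, w t s a * ℓ t s a) hy2
          linarith
      _ ≤ _ := by
          rw [PMF.expect_sub, PMF.expect_const]
          linarith

theorem Tuned.expect_runEpochs_potential_le (h : alg.Tuned) (hS : 2 ≤ Fintype.card S)
    (hD : M.diam ≠ ⊤) (hℓ : ∀ t s a, ℓ t s a ∈ Set.Icc (0 : ℝ) 1) (j : ℕ) :
    ((alg.runEpochs ℓ j).expect fun x => x.loss - alg.perturbedMin x.est) ≤
      -alg.perturbedMin 0 + j * alg.epochRegret := by
  induction j with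
  | zero => simp [runEpochs]
  | succ j ih =>
    rw [runEpochs, PMF.expect_bind]
    refine (PMF.expect_mono fun x hx => h.expect_epoch_potential_le hS hD hℓ j
      (valid_runEpochs hℓ (h.one_le_travelTime hS hD) j hx)).trans ?_
    rw [PMF.expect_add, PMF.expect_const]
    push_cast
    linarith

/-- The potential bound telescopes over the epochs, and the mean of Φ(estimators) is at most the
estimated, hence the true, cost of the best policy. -/
theorem Tuned.regret_le (h : alg.Tuned) (hS : 2 ≤ Fintype.card S) (hD : M.diam ≠ ⊤)
    [Nonempty A] (hℓ : ∀ t s a, ℓ t s a ∈ Set.Icc (0 : ℝ) 1) :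
    alg.regret ℓ ≤ -alg.perturbedMin 0 + alg.J * alg.epochRegret := by
  obtain ⟨π, hπ⟩ := exists_eq_ciInf_of_finite
    (f := fun π : S → A => M.policyCost (fun i : Fin T × S × A => ℓ i.1 i.2.1 i.2.2) π)
  have h0 : regret alg ℓ = (alg.runEpochs ℓ alg.J).expect (fun x => x.loss) -
      M.policyCost (fun i : Fin T × S × A => ℓ i.1 i.2.1 i.2.2) π := by
    rw [hπ]
    rfl
  have hl := h.one_le_travelTime hS hD
  have h1 := h.expect_runEpochs_potential_le hS hD hℓ alg.J
  have h2 := h.expect_runEpochs_linear_le hS hD hℓ (fun t s a => (M.occ π t s a).toReal)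
    (fun _ _ _ => ENNReal.toReal_nonneg) alg.J
  have h3 : ((alg.runEpochs ℓ alg.J).expect fun x => alg.perturbedMin x.est) ≤
      M.policyCost (fun i : Fin T × S × A => ℓ i.1 i.2.1 i.2.2) π := by
    have h4 : ((alg.runEpochs ℓ alg.J).expect fun x => alg.perturbedMin x.est) ≤
        ((alg.runEpochs ℓ alg.J).expect fun x =>
          (pairing (fun t s a => (M.occ π t s a).toReal) x.est -
            ∑ t ∈ Finset.range x.t, ∑ s, ∑ a, (M.occ π t s a).toReal * ℓ t s a) +
          M.policyCost (fun i : Fin T × S × A => ℓ i.1 i.2.1 i.2.2) π) := by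
      refine PMF.expect_mono fun x hx => ?_
      have e1 := alg.perturbedMin_le x.est π
      rw [M.policyCost_eq_pairing] at e1 ⊢
      rw [pairing_restrict]
      have e2 : ∑ t ∈ Finset.range x.t, ∑ s, ∑ a, (M.occ π t s a).toReal * ℓ t s a ≤
          ∑ t ∈ Finset.range T, ∑ s, ∑ a, (M.occ π t s a).toReal * ℓ t s a :=
        Finset.sum_le_sum_of_subset_of_nonneg
          (Finset.range_mono (valid_runEpochs hℓ hl alg.J hx).t_le) fun t _ _ =>
          Finset.sum_nonneg fun s _ => Finset.sum_nonneg fun a _ =>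
            mul_nonneg ENNReal.toReal_nonneg (hℓ t s a).1
      linarith
    rw [PMF.expect_add, PMF.expect_const] at h4
    linarith
  rw [PMF.expect_sub] at h1
  rw [h0]
  linarith

theorem Tuned.regret_le_horizon (h : alg.Tuned) (hS : 2 ≤ Fintype.card S) (hD : M.diam ≠ ⊤)
    [Nonempty A] (hℓ : ∀ t s a, ℓ t s a ∈ Set.Icc (0 : ℝ) 1) : alg.regret ℓ ≤ T := by
  have h1 : (alg.run ℓ).expect (fun x => x.loss) ≤ T := by
    have : (alg.run ℓ).FinSupp := finSupp_runEpochs alg ℓ alg.J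
    refine PMF.expect_le_of_le fun x hx => ?_
    have hv := valid_runEpochs hℓ (h.one_le_travelTime hS hD) alg.J hx
    exact hv.loss_le.trans (by exact_mod_cast hv.t_le)
  have h2 : 0 ≤ ⨅ π : S → A, M.policyCost (fun i : Fin T × S × A => ℓ i.1 i.2.1 i.2.2) π :=
    le_ciInf fun π => M.policyCost_nonneg (fun i => (hℓ _ _ _).1) π
  have h3 : alg.regret ℓ = (alg.run ℓ).expect (fun x => x.loss) -
      ⨅ π : S → A, M.policyCost (fun i : Fin T × S × A => ℓ i.1 i.2.1 i.2.2) π := rfl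
  linarith

theorem Tuned.calls_draws_le (h : alg.Tuned) (hS : 2 ≤ Fintype.card S) (hD : M.diam ≠ ⊤)
    (hℓ : ∀ t s a, ℓ t s a ∈ Set.Icc (0 : ℝ) 1) {x : RunState S A T}
    (hx : x ∈ (alg.run ℓ).support) :
    x.calls ≤ alg.J + T * alg.L ∧
      x.draws ≤ (alg.J + T * alg.L) * (T * Fintype.card S * Fintype.card A) +
        T * alg.L + 2 * T := by
  have hv := valid_runEpochs hℓ (h.one_le_travelTime hS hD) alg.J hx
  have ht := hv.t_le
  refine ⟨hv.calls_le.trans (by gcongr), hv.draws_le.trans (by gcongr)⟩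

end FTPL

/-! ### Existence of an oracle, travel policies and travel times -/

namespace MDP

variable {S A : Type*} [Fintype S] [Fintype A] [DecidableEq S] [DecidableEq A]

/-- Choosing the first minimizer in a fixed enumeration of the policies makes the choice measurable.
-/
theorem nonempty_planningOracle (M : MDP S A) (T : ℕ) [Nonempty A] :
    Nonempty (M.PlanningOracle T) := by
  classical
  set e := Fintype.equivFin (S → A)
  set B : (S → A) → Set (Fin T × S × A → ℝ) :=
    fun π => {c | ∀ π', M.policyCost c π ≤ M.policyCost c π'} with hB
  have hBm : ∀ π, MeasurableSet (B π) := fun π => by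
    simp only [hB, Set.ofPred_forall]
    exact MeasurableSet.iInter fun π' =>
      measurableSet_le (M.measurable_policyCost π) (M.measurable_policyCost π')
  have hex : ∀ c, ∃ π, c ∈ B π ∧ ∀ π', c ∈ B π' → e π ≤ e π' := by
    intro c
    obtain ⟨π₀, -, h₀⟩ := Finset.exists_min_image Finset.univ (M.policyCost c)
      Finset.univ_nonempty
    obtain ⟨π, h, h'⟩ := Finset.exists_min_image (Finset.univ.filter fun π => c ∈ B π) e
      ⟨π₀, by simpa [hB] using h₀⟩
    exact ⟨π, by simpa using h, fun π' hπ' => h' π' (by simpa using hπ')⟩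
  choose plan hplan hfirst using hex
  refine ⟨plan, hplan, fun π => ?_⟩
  have hset : {c | plan c = π} = B π ∩ ⋂ π', {c | c ∈ B π' → e π ≤ e π'} := by
    ext c
    simp only [Set.mem_ofPred_eq, Set.mem_inter_iff, Set.mem_iInter]
    constructor
    · rintro rfl
      exact ⟨hplan c, hfirst c⟩
    · rintro ⟨h1, h2⟩
      exact e.injective (le_antisymm (hfirst c π h1) (h2 _ (hplan c)))
  rw [hset]
  refine (hBm π).inter (MeasurableSet.iInter fun π' => ?_)
  by_cases h : e π ≤ e π'
  · simp [h]
  · have hc : {c | c ∈ B π' → e π ≤ e π'} = (B π')ᶜ := by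
      ext c
      simp [h]
    rw [hc]
    exact (hBm π').compl

theorem exists_expHit_le_diam (M : MDP S A) [Nonempty A] (s s' : S) :
    ∃ π : S → A, s ≠ s' → M.expHit π s' s ≤ M.diam := by
  obtain ⟨π, hπ⟩ := exists_eq_ciInf_of_finite (f := fun π : S → A => M.expHit π s' s)
  refine ⟨π, fun h => ?_⟩
  rw [hπ, diam]
  exact le_iSup₂_of_le s s' (le_iSup_of_le h le_rfl)

theorem tsum_hitProb_eq_one (M : MDP S A) {π : S → A} {g s : S} (h : M.expHit π g s ≠ ⊤) :
    ∑' n, M.hitProb π g n s = 1 := by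
  refine le_antisymm (M.tsum_hitProb_le_one π g s) (le_of_not_gt fun h1 => h ?_)
  rw [expHit, ENNReal.top_mul (tsub_pos_of_lt h1).ne', add_top]

/-- Markov's inequality for the hitting time. -/
theorem mul_tsum_hitProb_le (M : MDP S A) (π : S → A) (g s : S) (k : ℕ) :
    (k : ℝ≥0∞) * ∑' n, M.hitProb π g (n + k) s ≤ M.expHit π g s := by
  calc _ = ∑' n, (k : ℝ≥0∞) * M.hitProb π g (n + k) s := ENNReal.tsum_mul_left.symm
    _ ≤ ∑' n, ((n + k : ℕ) : ℝ≥0∞) * M.hitProb π g (n + k) s :=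
        ENNReal.tsum_le_tsum fun n =>
          mul_le_mul_left (Nat.cast_le.2 (Nat.le_add_left k n)) _
    _ ≤ ∑' n : ℕ, (n : ℝ≥0∞) * M.hitProb π g n s :=
        ENNReal.tsum_comp_le_tsum_of_injective (add_left_injective k)
          fun n : ℕ => (n : ℝ≥0∞) * M.hitProb π g n s
    _ ≤ M.expHit π g s := le_self_add

/-- By Markov's inequality `g` is hit within time 2D with probability more than 1/2; time 0 is
excluded by s ≠ g, so one of at most 2D times carries mass at least 1/(4D). -/
theorem exists_hitProb_ge_toReal (M : MDP S A) {π : S → A} {g s : S} (hs : s ≠ g) {D : ℝ}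
    (hD1 : 1 ≤ D) (hfin : M.expHit π g s ≠ ⊤) (h : (M.expHit π g s).toReal ≤ D) :
    ∃ l : ℕ, (l : ℝ) ≤ 2 * D ∧ 1 / (4 * D) ≤ (M.hitProb π g l s).toReal := by
  by_contra! hlt
  obtain ⟨N, hN1, hN2⟩ : ∃ N : ℕ, (N : ℝ) ≤ 2 * D ∧ 2 * D < N + 1 :=
    ⟨⌊2 * D⌋₊, Nat.floor_le (by positivity), Nat.lt_floor_add_one _⟩
  have hF := M.tsum_hitProb_eq_one hfin
  have htop : ∀ n, M.hitProb π g n s ≠ ⊤ := fun n =>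
    ne_top_of_le_ne_top ENNReal.one_ne_top (le_trans (ENNReal.le_tsum n) hF.le)
  have hhead : (∑ n ∈ Finset.range (N + 1), M.hitProb π g n s).toReal ≤ 1 / 2 := by
    rw [ENNReal.toReal_sum fun n _ => htop _, Finset.sum_range_succ']
    have h0 : M.hitProb π g 0 s = 0 := by simp [hitProb, hs]
    rw [h0, ENNReal.toReal_zero, add_zero]
    calc ∑ n ∈ Finset.range N, (M.hitProb π g (n + 1) s).toReal
        ≤ ∑ _n ∈ Finset.range N, 1 / (4 * D) := by
          refine Finset.sum_le_sum fun n hn => (hlt (n + 1) (le_trans ?_ hN1)).le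
          exact Nat.cast_le.2 (Finset.mem_range.1 hn)
      _ = N * (1 / (4 * D)) := by rw [Finset.sum_const, Finset.card_range, nsmul_eq_mul]
      _ ≤ 2 * D * (1 / (4 * D)) := by gcongr
      _ = 1 / 2 := by field_simp; norm_num
  have hsplit : ∑ n ∈ Finset.range (N + 1), M.hitProb π g n s +
      ∑' n, M.hitProb π g (n + (N + 1)) s = 1 := by
    rw [← hF]
    exact ENNReal.summable.sum_add_tsum_nat_add' (f := fun n => M.hitProb π g n s) (k := N + 1)
  have hmark := M.mul_tsum_hitProb_le π g s (N + 1)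
  generalize ∑' n, M.hitProb π g (n + (N + 1)) s = tail at hsplit hmark
  have htail : tail ≠ ⊤ := ne_top_of_le_ne_top ENNReal.one_ne_top (hsplit ▸ le_add_self)
  have hreal := congrArg ENNReal.toReal hsplit
  rw [ENNReal.toReal_add (ENNReal.sum_ne_top.2 fun n _ => htop _) htail,
    ENNReal.toReal_one] at hreal
  have hmark' := ENNReal.toReal_mono hfin hmark
  rw [ENNReal.toReal_mul, ENNReal.toReal_natCast] at hmark'
  push_cast at hmark'
  have : 1 / 2 ≤ tail.toReal := by linarith
  nlinarith

theorem exists_hitProb_ge (M : MDP S A) {π : S → A} {g s : S} (hs : s ≠ g) {D : ℝ≥0∞}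
    (hD : D ≠ ⊤) (hD1 : 1 ≤ D) (h : M.expHit π g s ≤ D) :
    ∃ l : ℕ, (l : ℝ≥0∞) ≤ 2 * D ∧ 1 / (4 * D) ≤ M.hitProb π g l s := by
  have hfin := ne_top_of_le_ne_top hD h
  have hF := M.tsum_hitProb_eq_one hfin
  have htop : ∀ n, M.hitProb π g n s ≠ ⊤ := fun n =>
    ne_top_of_le_ne_top ENNReal.one_ne_top (le_trans (ENNReal.le_tsum n) hF.le)
  obtain ⟨l, h1, h2⟩ := M.exists_hitProb_ge_toReal hs (D := D.toReal)
    (by simpa using ENNReal.toReal_mono hD hD1) hfin (ENNReal.toReal_mono hD h)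
  refine ⟨l, ?_, ?_⟩
  · rw [← ENNReal.toReal_le_toReal (ENNReal.natCast_ne_top l)
      (ENNReal.mul_ne_top (by norm_num) hD)]
    simpa using h1
  · rw [← ENNReal.toReal_le_toReal (ENNReal.div_ne_top ENNReal.one_ne_top
      (mul_ne_zero (by norm_num) (zero_lt_one.trans_le hD1).ne')) (htop l)]
    simpa using h2

end MDP

theorem FTPL.exists_tuned {S A : Type*} [Fintype S] [Fintype A] [DecidableEq S] [DecidableEq A]
    (M : MDP S A) {T : ℕ} (hS : 2 ≤ Fintype.card S) (hT : 0 < T) (hD : M.diam ≠ ⊤) {park : S}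
    {stay : A} (hpark : M.P park stay park = 1) : ∃ alg : FTPL M T, alg.Tuned := by
  have : Nonempty A := ⟨stay⟩
  obtain ⟨oracle⟩ := M.nonempty_planningOracle T
  choose nav hnav using M.exists_expHit_le_diam
  have hlen : ∀ g, ∃ l : ℕ, (g = park → l = 0) ∧ (g ≠ park → (l : ℝ≥0∞) ≤ 2 * M.diam ∧
      1 / (4 * M.diam) ≤ M.hitProb (nav park g) g l park) := by
    intro g
    by_cases hg : g = park
    · exact ⟨0, fun _ => rfl, fun h => absurd hg h⟩
    · obtain ⟨l, hl⟩ := M.exists_hitProb_ge (Ne.symm hg) hD (M.one_le_diam hS)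
        (hnav park g (Ne.symm hg))
      exact ⟨l, fun h => absurd h hg, fun _ => hl⟩
  choose len hlen0 hlen using hlen
  have hD1 := MDP.one_le_diam_toReal hS hD
  have hS0 : (0 : ℝ) < Fintype.card S := by exact_mod_cast (by omega : 0 < Fintype.card S)
  have hT0 : (0 : ℝ) < T := by exact_mod_cast hT
  have hη : 0 < (Fintype.card S : ℝ) ^ (1 / 3 : ℝ) /
      (M.diam.toReal ^ (2 / 3 : ℝ) * (T : ℝ) ^ (1 / 3 : ℝ)) := by positivity
  exact ⟨⟨oracle, _, hη, _, _, park, stay, nav, len⟩, hpark, hnav, hlen0 park rfl,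
    fun g hg => (hlen g hg).1, fun g hg => (hlen g hg).2, rfl, rfl, rfl⟩

/-! ### Balancing the parameters -/

/-- The trade-off between the parameters of the algorithm, where `a`, `d`, `α` and `τ` are the
cube roots of the number of states and of the diameter, the square root of the number of actions
and the sixth root of the horizon. -/
theorem tuning_le {a d α τ J L H : ℝ} (ha : 1 ≤ a) (hd : 1 ≤ d) (hα : 1 ≤ α) (hτ : 0 < τ)
    (hreg : α * a ^ 2 * d ^ 2 ≤ τ)
    (hJ2 : J ≤ 2 * (a ^ 2 * α * τ ^ 5 / d ^ 4))
    (hH0 : 0 ≤ H) (hH : H ≤ 2 * (τ * d ^ 4 / (a ^ 2 * α))) (hL : a * α * τ / d ^ 2 ≤ L) :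
    J * (12 * (d ^ 3) ^ 2 + H * (a ^ 3 * α ^ 2 / (L + 1) +
      a / (d ^ 2 * τ ^ 2) * (H + 1) * (a ^ 3 * α ^ 2))) ≤ 40 * (α * a ^ 2 * d ^ 2 * τ ^ 5) := by
  have ha0 : 0 < a := by linarith
  have hd0 : 0 < d := by linarith
  have hα0 : 0 < α := by linarith
  -- `y` is T/J without rounding; y ≥ 1 gives H + 1 ≤ 3y.
  set y := τ * d ^ 4 / (a ^ 2 * α) with hy
  have hy1 : 1 ≤ y := by
    rw [hy, one_le_div (by positivity)]
    calc a ^ 2 * α = α * a ^ 2 * 1 := by ring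
      _ ≤ α * a ^ 2 * d ^ 2 := by gcongr; exact one_le_pow₀ hd
      _ ≤ τ * 1 := by linarith
      _ ≤ τ * d ^ 4 := by gcongr; exact one_le_pow₀ hd
  have hL0 : 0 < L + 1 := by
    have : 0 < a * α * τ / d ^ 2 := by positivity
    linarith
  -- Rounding up loses a factor of at most two in `J` and in `H`, so J·H ≤ 4T.
  have hJH : J * H ≤ 4 * τ ^ 6 := by
    calc J * H ≤ (2 * (a ^ 2 * α * τ ^ 5 / d ^ 4)) * (2 * y) := by gcongr
      _ = 4 * τ ^ 6 := by rw [hy]; field_simp; norm_num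
  have h1 : J * (12 * (d ^ 3) ^ 2) ≤ 24 * (α * a ^ 2 * d ^ 2 * τ ^ 5) := by
    calc _ ≤ (2 * (a ^ 2 * α * τ ^ 5 / d ^ 4)) * (12 * (d ^ 3) ^ 2) := by gcongr
      _ = _ := by field_simp; ring
  have h2 : J * H * (a ^ 3 * α ^ 2 / (L + 1)) ≤ 4 * (α * a ^ 2 * d ^ 2 * τ ^ 5) := by
    calc _ ≤ 4 * τ ^ 6 * (a ^ 3 * α ^ 2 / (a * α * τ / d ^ 2)) := by
          gcongr
          linarith
      _ = _ := by field_simp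
  have h3 : J * H * (a / (d ^ 2 * τ ^ 2) * (H + 1) * (a ^ 3 * α ^ 2)) ≤
      12 * (α * a ^ 2 * d ^ 2 * τ ^ 5) := by
    calc _ ≤ 4 * τ ^ 6 * (a / (d ^ 2 * τ ^ 2) * (3 * y) * (a ^ 3 * α ^ 2)) := by
          gcongr
          linarith
      _ = _ := by rw [hy]; field_simp; norm_num
  calc _ = J * (12 * (d ^ 3) ^ 2) + J * H * (a ^ 3 * α ^ 2 / (L + 1)) +
        J * H * (a / (d ^ 2 * τ ^ 2) * (H + 1) * (a ^ 3 * α ^ 2)) := by ring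
    _ ≤ _ := by linarith

/-- This is the price of the perturbation, (S log A + 1/2)·2√T/η, in the root variables, with b =
log A and √T = τ³. -/
theorem perturbation_le {a d α τ b : ℝ} (ha : 1 ≤ a) (hd : 1 ≤ d) (hα : 1 ≤ α) (hτ : 0 < τ)
    (hb : 0 ≤ b) :
    (a ^ 3 * b + 1 / 2) * (2 * τ ^ 3 / (a / (d ^ 2 * τ ^ 2))) ≤
      2 * (α * a ^ 2 * d ^ 2 * τ ^ 5) * b + α * a ^ 2 * d ^ 2 * τ ^ 5 := by
  have ha0 : 0 < a := by linarith
  have hd0 : 0 < d := by linarith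
  have e2 : (a ^ 3 * b + 1 / 2) * (2 * τ ^ 3 / (a / (d ^ 2 * τ ^ 2))) =
      2 * (1 * a ^ 2 * d ^ 2 * τ ^ 5) * b + 1 * 1 * d ^ 2 * τ ^ 5 / a := by
    field_simp
  rw [e2]
  refine add_le_add (by gcongr) ?_
  refine (div_le_self (by positivity) ha).trans ?_
  gcongr
  exact one_le_pow₀ ha

theorem Real.rpow_natCast_div {x : ℝ} (hx : 0 ≤ x) (m n : ℕ) :
    x ^ (m / n : ℝ) = (x ^ (1 / n : ℝ)) ^ m := by
  rw [← Real.rpow_natCast, ← Real.rpow_mul hx]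
  congr 1
  ring

theorem Real.rpow_one_div_natCast_pow {x : ℝ} (hx : 0 ≤ x) {n : ℕ} (hn : n ≠ 0) :
    (x ^ (1 / n : ℝ)) ^ n = x := by
  rw [one_div, Real.rpow_inv_natCast_pow hx hn]

namespace FTPL

variable {S A : Type*} [Fintype S] [Fintype A] [DecidableEq S] [DecidableEq A]
  {M : MDP S A} {T : ℕ} {ℓ : ℕ → S → A → ℝ} {alg : FTPL M T}

theorem Tuned.regret_le_rate (h : alg.Tuned) (hS : 2 ≤ Fintype.card S) (hT : 0 < T)
    (hD : M.diam ≠ ⊤) [Nonempty A] (hℓ : ∀ t s a, ℓ t s a ∈ Set.Icc (0 : ℝ) 1) :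
    alg.regret ℓ ≤ 41 * ((Fintype.card A : ℝ) ^ (1 / 2 : ℝ) *
      ((Fintype.card S : ℝ) * M.diam.toReal) ^ (2 / 3 : ℝ) * (T : ℝ) ^ (5 / 6 : ℝ)) *
      (1 + Real.log (Fintype.card S * Fintype.card A * T)) := by
  have hD1 := MDP.one_le_diam_toReal hS hD
  have hp : 0 < alg.stopProb.toReal := lt_of_lt_of_le (by positivity) (h.inv_le_stopProb hS)
  have hK : 3 * M.diam.toReal / alg.stopProb.toReal ≤ 12 * M.diam.toReal ^ 2 := by
    have := h.inv_le_stopProb hS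
    rw [div_le_iff₀ (by positivity)] at this
    rw [div_le_iff₀ hp]
    nlinarith
  have hmain := h.regret_le hS hD hℓ
  have hpert := alg.neg_perturbedMin_zero_le hT
  have htriv := h.regret_le_horizon hS hD hℓ
  rw [epochRegret] at hmain
  have hJ := h.J_eq
  have hL := h.L_eq
  have hη := h.η_eq
  have hH : alg.epochLength = ⌈(T : ℝ) / alg.J⌉₊ := rfl
  have hS1 : (1 : ℝ) ≤ Fintype.card S := by exact_mod_cast (by omega : 1 ≤ Fintype.card S)
  have hA1 : (1 : ℝ) ≤ Fintype.card A := by exact_mod_cast Fintype.card_pos (α := A)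
  have hT1 : (1 : ℝ) ≤ T := by exact_mod_cast hT
  have hlogA : 0 ≤ Real.log (Fintype.card A) := Real.log_nonneg hA1
  have hlog : Real.log (Fintype.card A) ≤ Real.log (Fintype.card S * Fintype.card A * T) := by
    refine Real.log_le_log (by linarith) ?_
    calc (Fintype.card A : ℝ) = 1 * Fintype.card A * 1 := by ring
      _ ≤ _ := by gcongr
  set s := (Fintype.card S : ℝ)
  set D := M.diam.toReal
  set n := (Fintype.card A : ℝ)
  set t := (T : ℝ)
  have hs0 : 0 ≤ s := by linarith
  have hD0 : 0 ≤ D := by linarith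
  have hn0 : 0 ≤ n := by linarith
  have ht0 : 0 ≤ t := by linarith
  -- With these roots as variables all exponents are integers, so `field_simp` and `ring` can verify
  -- the balance.
  obtain ⟨a, ha⟩ : ∃ a, a = s ^ (1 / 3 : ℝ) := ⟨_, rfl⟩
  obtain ⟨d, hd⟩ : ∃ d, d = D ^ (1 / 3 : ℝ) := ⟨_, rfl⟩
  obtain ⟨α, hα⟩ : ∃ α, α = n ^ (1 / 2 : ℝ) := ⟨_, rfl⟩
  obtain ⟨τ, hτ⟩ : ∃ τ, τ = t ^ (1 / 6 : ℝ) := ⟨_, rfl⟩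
  have ha1 : 1 ≤ a := ha ▸ Real.one_le_rpow hS1 (by norm_num)
  have hd1 : 1 ≤ d := hd ▸ Real.one_le_rpow hD1 (by norm_num)
  have hα1 : 1 ≤ α := hα ▸ Real.one_le_rpow hA1 (by norm_num)
  have hτ1 : 1 ≤ τ := hτ ▸ Real.one_le_rpow hT1 (by norm_num)
  have es2 : s ^ (2 / 3 : ℝ) = a ^ 2 := by
    rw [ha]
    exact_mod_cast Real.rpow_natCast_div hs0 2 3
  have eD2 : D ^ (2 / 3 : ℝ) = d ^ 2 := by
    rw [hd]
    exact_mod_cast Real.rpow_natCast_div hD0 2 3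
  have eD4 : D ^ (4 / 3 : ℝ) = d ^ 4 := by
    rw [hd]
    exact_mod_cast Real.rpow_natCast_div hD0 4 3
  have et5 : t ^ (5 / 6 : ℝ) = τ ^ 5 := by
    rw [hτ]
    exact_mod_cast Real.rpow_natCast_div ht0 5 6
  have et2 : t ^ (1 / 3 : ℝ) = τ ^ 2 := by
    have := Real.rpow_natCast_div ht0 2 6
    rw [hτ, ← (by exact_mod_cast this : t ^ (2 / 6 : ℝ) = (t ^ (1 / 6 : ℝ)) ^ 2)]
    norm_num
  have es : s = a ^ 3 := by
    rw [ha]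
    exact_mod_cast (Real.rpow_one_div_natCast_pow hs0 (n := 3) (by norm_num)).symm
  have eD : D = d ^ 3 := by
    rw [hd]
    exact_mod_cast (Real.rpow_one_div_natCast_pow hD0 (n := 3) (by norm_num)).symm
  have en : n = α ^ 2 := by
    rw [hα]
    exact_mod_cast (Real.rpow_one_div_natCast_pow hn0 (n := 2) (by norm_num)).symm
  have et : t = τ ^ 6 := by
    rw [hτ]
    exact_mod_cast (Real.rpow_one_div_natCast_pow ht0 (n := 6) (by norm_num)).symm
  have esqrt : √t = τ ^ 3 := by
    rw [et, show τ ^ 6 = (τ ^ 3) ^ 2 by ring, Real.sqrt_sq (by positivity)]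
  rw [Real.mul_rpow hs0 hD0, es2, eD2, et5, ← hα]
  rw [es2, ← hα, et5, eD4] at hJ
  rw [← ha, ← hα, ← hτ, eD2] at hL
  rw [← ha, eD2, et2] at hη
  set X := α * a ^ 2 * d ^ 2 * τ ^ 5 with hX
  have eX : α * (a ^ 2 * d ^ 2) * τ ^ 5 = X := by
    rw [hX]
    ring
  rw [eX]
  set lg := Real.log (s * n * t)
  have hX0 : 0 < X := by positivity
  -- If this fails, then T = τ·τ⁵ is below the claimed rate and the bound by the horizon suffices.
  -- If it holds, the unrounded `J` and T/J are at least 1, so rounding at most doubles them.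
  by_cases hreg : α * a ^ 2 * d ^ 2 ≤ τ
  swap
  · push Not at hreg
    have : t ≤ X := by
      rw [et, hX, show τ ^ 6 = τ * τ ^ 5 by ring]
      gcongr
    have := mul_nonneg hX0.le (hlogA.trans hlog)
    linarith
  set x := a ^ 2 * α * τ ^ 5 / d ^ 4 with hx
  have hx1 : 1 ≤ x := by
    rw [hx, one_le_div (by positivity)]
    have e1 : d ^ 2 ≤ τ := by
      refine le_trans ?_ hreg
      exact le_mul_of_one_le_left (by positivity) (one_le_mul_of_one_le_of_one_le hα1
        (one_le_pow₀ ha1))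
    calc d ^ 4 = 1 * 1 * (d ^ 2) ^ 2 := by ring
      _ ≤ a ^ 2 * α * τ ^ 2 := by
        gcongr
        exact one_le_pow₀ ha1
      _ ≤ a ^ 2 * α * τ ^ 5 := by
        gcongr
        norm_num
  have hJx : x ≤ alg.J := by
    rw [hJ]
    exact Nat.le_ceil _
  have hJ2 : (alg.J : ℝ) ≤ 2 * x := by
    rw [hJ]
    exact Nat.ceil_le_two_mul (by linarith)
  have hLx : a * α * τ / d ^ 2 ≤ alg.L := by
    rw [hL]
    exact Nat.le_ceil _
  have hHy : (alg.epochLength : ℝ) ≤ 2 * (τ * d ^ 4 / (a ^ 2 * α)) := by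
    have ey : t / x = τ * d ^ 4 / (a ^ 2 * α) := by
      rw [et, hx]
      field_simp
    have e1 : 1 ≤ t / x := by
      rw [ey, one_le_div (by positivity)]
      calc a ^ 2 * α = α * a ^ 2 * 1 := by ring
        _ ≤ α * a ^ 2 * d ^ 2 := by gcongr; exact one_le_pow₀ hd1
        _ ≤ τ * 1 := by linarith
        _ ≤ τ * d ^ 4 := by gcongr; exact one_le_pow₀ hd1
    have e2 : t / alg.J ≤ t / x := by gcongr
    have e3 : alg.epochLength ≤ ⌈t / x⌉₊ := hH ▸ Nat.ceil_mono e2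
    rw [← ey]
    exact le_trans (by exact_mod_cast e3) (Nat.ceil_le_two_mul (by linarith))
  have htune := tuning_le ha1 hd1 hα1 (by linarith : 0 < τ) hreg hJ2
    (Nat.cast_nonneg _) hHy hLx
  have hJK : (alg.J : ℝ) * (3 * D / alg.stopProb.toReal + alg.epochLength *
      (s * n / (alg.L + 1) + alg.η * (alg.epochLength + 1) * (s * n))) ≤ 40 * X := by
    refine le_trans ?_ htune
    rw [← eD, ← es, ← en, ← hη]
    gcongr
  have hP : (s * Real.log n + 1 / 2) * (2 * √t / alg.η) ≤ 2 * X * Real.log n + X := by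
    rw [es, esqrt, hη]
    exact perturbation_le ha1 hd1 hα1 (by linarith) hlogA
  have hXlog : X * Real.log n ≤ X * lg := mul_le_mul_of_nonneg_left hlog hX0.le
  have hXlog0 : 0 ≤ X * lg := mul_nonneg hX0.le (hlogA.trans hlog)
  linarith

end FTPL

theorem mainTheorem5 :
    ∃ (C : ℝ) (k : ℕ), ∀ (S A : Type*) [Fintype S] [Fintype A] [DecidableEq S] [DecidableEq A]
      (M : MDP S A) (T : ℕ), 2 ≤ Fintype.card S → 0 < T → M.diam ≠ ⊤ →
      (∃ s a, M.P s a s = 1) →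
      (∃ alg : FTPL M T, alg.Tuned) ∧
      ∀ alg : FTPL M T, alg.Tuned →
        ∀ ℓ : ℕ → S → A → ℝ, (∀ t s a, ℓ t s a ∈ Set.Icc (0 : ℝ) 1) →
          alg.regret ℓ ≤ C *
              ((Fintype.card A : ℝ) ^ (1 / 2 : ℝ) *
                ((Fintype.card S : ℝ) * M.diam.toReal) ^ (2 / 3 : ℝ) *
                (T : ℝ) ^ (5 / 6 : ℝ)) *
              (1 + Real.log (Fintype.card S * Fintype.card A * T)) ^ k ∧
          ∀ x ∈ (alg.run ℓ).support,
            x.calls ≤ alg.J + T * alg.L ∧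
            x.draws ≤ (alg.J + T * alg.L) * (T * Fintype.card S * Fintype.card A) +
              T * alg.L + 2 * T := by
  -- 40 comes from the epochs and 1 from the constant part of the perturbation price; its
  -- logarithmic part, with factor 2, fits into the 41 multiplying the logarithm.
  refine ⟨41, 1, ?_⟩
  intro S A _ _ _ _ M T hS hT hD hpark
  obtain ⟨park, stay, hstay⟩ := hpark
  have : Nonempty A := ⟨stay⟩
  refine ⟨FTPL.exists_tuned M hS hT hD hstay, fun alg h ℓ hℓ => ⟨?_, fun x hx =>
    h.calls_draws_le hS hD hℓ hx⟩⟩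
  rw [pow_one]
  exact h.regret_le_rate hS hT hD hℓ
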